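/- Let $n\ge 2$ and $R_3=\mathbb Z[q^{\pm1},(q+1)^{-1},\tfrac12]$ with $q$ an indeterminate. Let $\mathscr H=\mathscr H_{R_3,B_n}(1,q)$ be the $R_3$-algebra with generators $a_1,\dots,a_n$ and relations $a_1^2=1$; $a_i^2=(q-1)a_i+q$ for $2\le i\le n$; $a_1a_2a_1a_2=a_2a_1a_2a_1$; $a_ia_{i+1}a_i=a_{i+1}a_ia_{i+1}$ for $2\le i\le n-1$; $a_ia_j=a_ja_i$ for $|i-j|>1$. Let $\sharp,\flat,\natural$ be the $R_3$-algebra involutions of $\mathscr H$ given by $a_1^\sharp=-a_1$, $a_i^\sharp=a_i$; $a_1^\flat=a_1$, $a_i^\flat=(q-1)-a_i$; $a_1^\natural=-a_1$, $a_i^\natural=(q-1)-a_i$ (for $i\ge2$), and let $\mathscr H^\sharp,\mathscr H^\flat,\mathscr H^\natural$ be the subalgebras of fixed elements. Put $b_1=\frac{a_1-a_1^\natural}{2}$ and $b_i=\frac{a_i-a_i^\natural}{q+1}$ for $i\ge2$, and put $\bar b_1=b_1b_2b_1$ and $\bar b_i=b_i$ for $i\ge2$. Let $\mathscr H^\dagger$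 be the subalgebra of $\mathscr H$ generated by all products of an even number of factors among $\bar b_1,\dots,\bar b_n$. A normal-form monomial is a word $U_1U_2\cdots U_n$, where each $U_i$ is one of the $2i$ proper or improper initial segments (the empty one included) of $b_ib_{i-1}\cdots b_2b_1b_2\cdots b_{i-1}b_i$ (of the word $b_1$ if $i=1$). Let $X_n,Y_n,Z_n,W_n$ be the sets of normal-form monomials for which (the number of occurrences of $b_1$, the total number of occurrences of $b_2,\dots,b_n$) has parity (even, even), (odd, even), (even, odd), (odd, odd), respectively. For a finite group $S$ and a commutative ring $R$, an $R$-algebra $A$ that is finitely generated as an $R$-module is an $S$-crossed product with $R$-submodules $(A_s)_{s\in S}$ if $A_sA_t=A_{st}$ for all $s,t\in S$; for each $s\in S$ there is a unit $a_s\in A$ with $A_s=a_sA_1=A_1a_s$; $A=\bigoplus_{s\in S}A_s$; and $1\in A_1$, where the index $1$ is the identity of $S$. For $S=\mathbb Z_2=\{\bar0,\bar1\}$ the identity is $\bar0$. **Theorem 5.4.** One has $$\mathscr H^\dagger=\mathscr H^\sharp\cap\mathscr H^\natural=\mathscr H^\flat\cap\mathscr H^\sharp=\mathscr H^\natural\cap\mathscr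 H^\flat=\bigoplus_{M\in X_n}R_3M,$$ and each of $\mathscr H^\sharp$, $\mathscr H^\flat$, $\mathscr H^\natural$ is a $\mathbb Z_2$-crossed product over $R_3$ with $A_{\bar0}=\mathscr H^\dagger$ and with $$A_{\bar1}=\bigoplus_{M\in Z_n}R_3M,\qquad A_{\bar1}=\bigoplus_{M\in Y_n}R_3M,\qquad A_{\bar1}=\bigoplus_{M\in W_n}R_3M,$$ respectively. Here each $\bigoplus_{M\in C}R_3M$ is free over $R_3$ with the monomials $M\in C$, read in $\mathscr H$, as a basis. -/

import Mathlib

open Polynomial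

noncomputable section

/-- The ring `ℤ[q, q⁻¹, (q + 1)⁻¹, 1/2]`, i.e. `ℤ[X]` with `2`, `X` and `X + 1` inverted. -/
def R3 : Type := Localization.Away (2 * X * (X + 1) : ℤ[X])

instance : CommRing R3 := inferInstanceAs (CommRing (Localization.Away (2 * X * (X + 1) : ℤ[X])))

instance : Algebra ℤ[X] R3 :=
  inferInstanceAs (Algebra ℤ[X] (Localization.Away (2 * X * (X + 1) : ℤ[X])))

instance : IsLocalization.Away (2 * X * (X + 1) : ℤ[X]) R3 :=
  inferInstanceAs (IsLocalization.Away (2 * X * (X + 1) : ℤ[X])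
    (Localization.Away (2 * X * (X + 1) : ℤ[X])))

/-- The indeterminate `q`, as an element of `R3`. -/
def R3.q : R3 := algebraMap ℤ[X] R3 X

theorem R3.isUnit_prod : IsUnit (2 * R3.q * (R3.q + 1)) := by
  have h := IsLocalization.Away.algebraMap_isUnit (S := R3) (2 * X * (X + 1) : ℤ[X])
  rwa [map_mul, map_mul, map_add, map_one, map_ofNat] at h

theorem R3.isUnit_two : IsUnit ((1 : R3) + 1) := by
  rw [one_add_one_eq_two]
  exact isUnit_of_mul_isUnit_left (isUnit_of_mul_isUnit_left R3.isUnit_prod)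

theorem R3.isUnit_q_add_one : IsUnit (R3.q + 1) :=
  isUnit_of_mul_isUnit_right R3.isUnit_prod

section HeckeAlgebra

/-- The defining relations of the Iwahori-Hecke algebra of type `B_n` with parameters `u`, `q`.
The generator `a_{i+1}` is the variable with (zero-based) index `i : Fin n`. -/
inductive HeckeBRel (R : Type) [CommRing R] (n : ℕ) (u q : R) :
    FreeAlgebra R (Fin n) → FreeAlgebra R (Fin n) → Prop
  | quad_first (i : Fin n) (hi : i.val = 0) :
      HeckeBRel R n u q (FreeAlgebra.ι R i * FreeAlgebra.ι R i)
        ((u - 1) • FreeAlgebra.ι R i + algebraMap R (FreeAlgebra R (Fin n)) u)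
  | quad (i : Fin n) (hi : i.val ≠ 0) :
      HeckeBRel R n u q (FreeAlgebra.ι R i * FreeAlgebra.ι R i)
        ((q - 1) • FreeAlgebra.ι R i + algebraMap R (FreeAlgebra R (Fin n)) q)
  | braid_four (i j : Fin n) (hi : i.val = 0) (hj : j.val = 1) :
      HeckeBRel R n u q
        (FreeAlgebra.ι R i * FreeAlgebra.ι R j * FreeAlgebra.ι R i * FreeAlgebra.ι R j)
        (FreeAlgebra.ι R j * FreeAlgebra.ι R i * FreeAlgebra.ι R j * FreeAlgebra.ι R i)
  | braid_three (i j : Fin n) (hi : i.val ≠ 0) (hj : j.val = i.val + 1) :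
      HeckeBRel R n u q
        (FreeAlgebra.ι R i * FreeAlgebra.ι R j * FreeAlgebra.ι R i)
        (FreeAlgebra.ι R j * FreeAlgebra.ι R i * FreeAlgebra.ι R j)
  | comm (i j : Fin n) (hij : i.val + 1 < j.val ∨ j.val + 1 < i.val) :
      HeckeBRel R n u q
        (FreeAlgebra.ι R i * FreeAlgebra.ι R j) (FreeAlgebra.ι R j * FreeAlgebra.ι R i)

/-- The Iwahori-Hecke algebra of type `B_n` over `R` with parameters `u`, `q`. -/
def HeckeB (R : Type) [CommRing R] (n : ℕ) (u q : R) : Type :=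
  RingQuot (HeckeBRel R n u q)

instance (R : Type) [CommRing R] (n : ℕ) (u q : R) : Ring (HeckeB R n u q) :=
  inferInstanceAs (Ring (RingQuot (HeckeBRel R n u q)))

instance (R : Type) [CommRing R] (n : ℕ) (u q : R) : Algebra R (HeckeB R n u q) :=
  inferInstanceAs (Algebra R (RingQuot (HeckeBRel R n u q)))

/-- The generator `a_{i+1}` of the Hecke algebra. -/
def HeckeB.a {R : Type} [CommRing R] {n : ℕ} {u q : R} (i : Fin n) : HeckeB R n u q :=
  RingQuot.mkAlgHom R (HeckeBRel R n u q) (FreeAlgebra.ι R i)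

/-- The defining relations, for a family of elements of an algebra. -/
structure HeckeB.Relations {R : Type} [CommRing R] {n : ℕ} (u q : R)
    {A : Type} [Ring A] [Algebra R A] (f : Fin n → A) : Prop where
  quad_first : ∀ i : Fin n, i.val = 0 → f i * f i = (u - 1) • f i + algebraMap R A u
  quad : ∀ i : Fin n, i.val ≠ 0 → f i * f i = (q - 1) • f i + algebraMap R A q
  braid_four : ∀ i j : Fin n, i.val = 0 → j.val = 1 → f i * f j * f i * f j = f j * f i * f j * f i
  braid_three : ∀ i j : Fin n, i.val ≠ 0 → j.val = i.val + 1 → f i * f j * f i = f j * f i * f j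
  comm : ∀ i j : Fin n, i.val + 1 < j.val ∨ j.val + 1 < i.val → f i * f j = f j * f i

theorem HeckeB.relations_a {R : Type} [CommRing R] {n : ℕ} {u q : R} :
    HeckeB.Relations u q (HeckeB.a : Fin n → HeckeB R n u q) where
  quad_first i hi := by
    have h := RingQuot.mkAlgHom_rel R (HeckeBRel.quad_first (u := u) (q := q) i hi)
    simp only [map_mul, map_add, map_smul, AlgHom.commutes] at h
    exact h
  quad i hi := by
    have h := RingQuot.mkAlgHom_rel R (HeckeBRel.quad (u := u) (q := q) i hi)
    simp only [map_mul, map_add, map_smul, AlgHom.commutes] at h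
    exact h
  braid_four i j hi hj := by
    have h := RingQuot.mkAlgHom_rel R (HeckeBRel.braid_four (u := u) (q := q) i j hi hj)
    simp only [map_mul] at h
    exact h
  braid_three i j hi hj := by
    have h := RingQuot.mkAlgHom_rel R (HeckeBRel.braid_three (u := u) (q := q) i j hi hj)
    simp only [map_mul] at h
    exact h
  comm i j hij := by
    have h := RingQuot.mkAlgHom_rel R (HeckeBRel.comm (u := u) (q := q) i j hij)
    simp only [map_mul] at h
    exact h

/-- The universal property: a family satisfying the relations extends to an algebra map. -/
def HeckeB.lift {R : Type} [CommRing R] {n : ℕ} {u q : R}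
    {A : Type} [Ring A] [Algebra R A] (f : Fin n → A) (hf : HeckeB.Relations u q f) :
    HeckeB R n u q →ₐ[R] A :=
  RingQuot.liftAlgHom R ⟨FreeAlgebra.lift R f, by
    intro x y h
    induction h with
    | quad_first i hi => simpa using hf.quad_first i hi
    | quad i hi => simpa using hf.quad i hi
    | braid_four i j hi hj => simpa using hf.braid_four i j hi hj
    | braid_three i j hi hj => simpa using hf.braid_three i j hi hj
    | comm i j hij => simpa using hf.comm i j hij⟩

theorem HeckeB.lift_a {R : Type} [CommRing R] {n : ℕ} {u q : R}
    {A : Type} [Ring A] [Algebra R A] (f : Fin n → A) (hf : HeckeB.Relations u q f) (i : Fin n) :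
    HeckeB.lift f hf (HeckeB.a i) = f i := by
  have h : HeckeB.lift f hf (HeckeB.a i) = FreeAlgebra.lift R f (FreeAlgebra.ι R i) :=
    RingQuot.liftAlgHom_mkAlgHom_apply R _ _ _
  rw [h, FreeAlgebra.lift_ι_apply]

end HeckeAlgebra

/-- The Hecke algebra of type `B_n` over `R3` with parameters `1` and `q`. -/
abbrev HB (n : ℕ) : Type := HeckeB R3 n 1 R3.q

namespace HB

theorem a_mul_a_of_eq_zero {n : ℕ} (i : Fin n) (hi : i.val = 0) :
    (HeckeB.a i * HeckeB.a i : HB n) = 1 := by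
  simpa using (HeckeB.relations_a (u := (1 : R3)) (q := R3.q)).quad_first i hi

/-- A quadratic relation is preserved by `x ↦ c - x`. -/
theorem quad_sub {A : Type} [Ring A] [Algebra R3 A] (c d : R3) (x : A)
    (hx : x * x = c • x + algebraMap R3 A d) :
    (algebraMap R3 A c - x) * (algebraMap R3 A c - x)
      = c • (algebraMap R3 A c - x) + algebraMap R3 A d := by
  simp only [Algebra.algebraMap_eq_smul_one] at hx ⊢
  simp only [mul_sub, sub_mul, hx, smul_mul_assoc, mul_smul_comm, one_mul, mul_one, smul_sub]
  abel

/-- The braid relation of length three is preserved by `x ↦ c - x`. -/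
theorem braid_sub {A : Type} [Ring A] [Algebra R3 A] (c d : R3) (x y : A)
    (hx : x * x = c • x + algebraMap R3 A d) (hy : y * y = c • y + algebraMap R3 A d)
    (h : x * y * x = y * x * y) :
    (algebraMap R3 A c - x) * (algebraMap R3 A c - y) * (algebraMap R3 A c - x)
      = (algebraMap R3 A c - y) * (algebraMap R3 A c - x) * (algebraMap R3 A c - y) := by
  simp only [Algebra.algebraMap_eq_smul_one] at hx hy ⊢
  simp only [mul_sub, sub_mul, hx, hy, h, smul_mul_assoc, mul_smul_comm, one_mul, mul_one,
    smul_sub, smul_add]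
  abel

theorem comm_sub {A : Type} [Ring A] [Algebra R3 A] (c d : R3) (x y : A) (h : x * y = y * x) :
    (algebraMap R3 A c - x) * (algebraMap R3 A d - y)
      = (algebraMap R3 A d - y) * (algebraMap R3 A c - x) := by
  have hc : Commute x y := h
  have h1 : Commute (algebraMap R3 A c) (algebraMap R3 A d - y) := Algebra.commutes c _
  have h2 : Commute x (algebraMap R3 A d) := (Algebra.commutes d x).symm
  exact h1.sub_left (h2.sub_right hc)

/-- The braid relation of length four is preserved by `y ↦ c - y`, if `x * x = 1`. -/
theorem braid_four_sub {A : Type} [Ring A] [Algebra R3 A] (c : R3) (x y : A)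
    (hx : x * x = 1) (h : x * y * x * y = y * x * y * x) :
    x * (algebraMap R3 A c - y) * x * (algebraMap R3 A c - y)
      = (algebraMap R3 A c - y) * x * (algebraMap R3 A c - y) * x := by
  simp only [Algebra.algebraMap_eq_smul_one]
  simp only [mul_sub, sub_mul, hx, h, smul_mul_assoc, mul_smul_comm, one_mul, mul_one, smul_sub]
  rw [mul_assoc y x x, hx, mul_one]
  abel

/-- The images of the generators under `♯`: `a_1 ↦ -a_1` and `a_i ↦ a_i` for `i ≥ 2`. -/
def sharpGen {n : ℕ} (i : Fin n) : HB n :=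
  if i.val = 0 then -HeckeB.a i else HeckeB.a i

/-- The images of the generators under `♭`: `a_1 ↦ a_1` and `a_i ↦ (q - 1) - a_i` for `i ≥ 2`. -/
def flatGen {n : ℕ} (i : Fin n) : HB n :=
  if i.val = 0 then HeckeB.a i else algebraMap R3 (HB n) (R3.q - 1) - HeckeB.a i

/-- The images of the generators under the Goldman involution `♮`:
`a_1 ↦ -a_1` and `a_i ↦ (q - 1) - a_i` for `i ≥ 2`. -/
def naturalGen {n : ℕ} (i : Fin n) : HB n :=
  if i.val = 0 then -HeckeB.a i else algebraMap R3 (HB n) (R3.q - 1) - HeckeB.a i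

theorem sharp_relations {n : ℕ} : HeckeB.Relations 1 R3.q (sharpGen : Fin n → HB n) where
  quad_first i hi := by simp [sharpGen, hi, a_mul_a_of_eq_zero i hi]
  quad i hi := by simpa [sharpGen, hi] using HeckeB.relations_a.quad i hi
  braid_four i j hi hj := by
    simpa [sharpGen, hi, hj] using HeckeB.relations_a.braid_four i j hi hj
  braid_three i j hi hj := by
    simpa [sharpGen, hi, hj] using HeckeB.relations_a.braid_three i j hi hj
  comm i j hij := by
    have h := (HeckeB.relations_a (u := (1 : R3)) (q := R3.q)).comm i j hij
    unfold sharpGen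
    split_ifs <;> simp [h]

theorem flat_relations {n : ℕ} : HeckeB.Relations 1 R3.q (flatGen : Fin n → HB n) where
  quad_first i hi := by simp [flatGen, hi, a_mul_a_of_eq_zero i hi]
  quad i hi := by
    simp only [flatGen, if_neg hi]
    exact quad_sub _ _ _ (HeckeB.relations_a.quad i hi)
  braid_four i j hi hj := by
    have hj' : j.val ≠ 0 := by omega
    simp only [flatGen, if_pos hi, if_neg hj']
    exact braid_four_sub _ _ _ (a_mul_a_of_eq_zero i hi) (HeckeB.relations_a.braid_four i j hi hj)
  braid_three i j hi hj := by
    have hj' : j.val ≠ 0 := by omega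
    simp only [flatGen, if_neg hi, if_neg hj']
    exact braid_sub _ _ _ _ (HeckeB.relations_a.quad i hi) (HeckeB.relations_a.quad j hj')
      (HeckeB.relations_a.braid_three i j hi hj)
  comm i j hij := by
    have h := (HeckeB.relations_a (u := (1 : R3)) (q := R3.q)).comm i j hij
    unfold flatGen
    split_ifs
    · exact h
    · have h1 : Commute (HeckeB.a i : HB n) (algebraMap R3 (HB n) (R3.q - 1)) :=
        (Algebra.commutes _ _).symm
      exact h1.sub_right h
    · have h1 : Commute (algebraMap R3 (HB n) (R3.q - 1)) (HeckeB.a j : HB n) :=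
        Algebra.commutes _ _
      exact h1.sub_left h
    · exact comm_sub _ _ _ _ h

theorem natural_relations {n : ℕ} : HeckeB.Relations 1 R3.q (naturalGen : Fin n → HB n) where
  quad_first i hi := by simp [naturalGen, hi, a_mul_a_of_eq_zero i hi]
  quad i hi := by
    simp only [naturalGen, if_neg hi]
    exact quad_sub _ _ _ (HeckeB.relations_a.quad i hi)
  braid_four i j hi hj := by
    have hj' : j.val ≠ 0 := by omega
    have h := flat_relations.braid_four i j hi hj
    simpa [flatGen, naturalGen, hi, hj'] using h
  braid_three i j hi hj := by
    have hj' : j.val ≠ 0 := by omega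
    have h := flat_relations.braid_three i j hi hj
    simpa only [flatGen, naturalGen, if_neg hi, if_neg hj'] using h
  comm i j hij := by
    have h := flat_relations.comm i j hij
    unfold flatGen at h
    unfold naturalGen
    split_ifs at h ⊢
    · rw [neg_mul_neg, neg_mul_neg, h]
    · rw [neg_mul, mul_neg, h]
    · rw [neg_mul, mul_neg, h]
    · exact h

/-- The involution `♯`. -/
def sharp (n : ℕ) : HB n →ₐ[R3] HB n := HeckeB.lift sharpGen sharp_relations

/-- The involution `♭`. -/
def flat (n : ℕ) : HB n →ₐ[R3] HB n := HeckeB.lift flatGen flat_relations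

/-- The Goldman involution `♮`. -/
def natural (n : ℕ) : HB n →ₐ[R3] HB n := HeckeB.lift naturalGen natural_relations

/-- The subalgebra of elements fixed by `♯`. -/
def fixedSharp (n : ℕ) : Subalgebra R3 (HB n) := AlgHom.equalizer (sharp n) (AlgHom.id R3 (HB n))

/-- The subalgebra of elements fixed by `♭`. -/
def fixedFlat (n : ℕ) : Subalgebra R3 (HB n) := AlgHom.equalizer (flat n) (AlgHom.id R3 (HB n))

/-- The subalgebra of elements fixed by `♮`. -/
def fixedNatural (n : ℕ) : Subalgebra R3 (HB n) :=
  AlgHom.equalizer (natural n) (AlgHom.id R3 (HB n))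

/-- The generators `b_1 = (a_1 - a_1^♮) / (1 + 1)` and `b_i = (a_i - a_i^♮) / (q + 1)`
for `i ≥ 2`; here `b i` is `b_{i+1}`. -/
def b {n : ℕ} (i : Fin n) : HB n :=
  if i.val = 0 then
    ((R3.isUnit_two.unit⁻¹ : R3ˣ) : R3) • (HeckeB.a i - natural n (HeckeB.a i))
  else
    ((R3.isUnit_q_add_one.unit⁻¹ : R3ˣ) : R3) • (HeckeB.a i - natural n (HeckeB.a i))

/-- The elements `b̄_1 = b_1 b_2 b_1` and `b̄_i = b_i` for `i ≥ 2`. -/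
def bbar {n : ℕ} (hn : 2 ≤ n) (i : Fin n) : HB n :=
  if i.val = 0 then b i * b ⟨1, hn⟩ * b i else b i

/-- The subalgebra `†` generated by all products of an even number of factors among
`b̄_1, …, b̄_n`. -/
def dagger {n : ℕ} (hn : 2 ≤ n) : Subalgebra R3 (HB n) :=
  Algebra.adjoin R3 {x | ∃ w : List (Fin n), Even w.length ∧ x = (w.map (bbar hn)).prod}

/-- The first `k` letters of the word `b_i b_{i-1} ⋯ b_2 b_1 b_2 ⋯ b_{i-1} b_i`
(indices shifted by one), where `0 ≤ k ≤ 2 i - 1`. -/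
def segment {n : ℕ} (i : Fin n) (k : Fin (2 * i.val + 2)) : List (Fin n) :=
  List.ofFn fun j : Fin k.val =>
    ⟨if j.val ≤ i.val then i.val - j.val else j.val - i.val, by
      have h1 := i.isLt
      have h2 := j.isLt
      have h3 := k.isLt
      split_ifs <;> omega⟩

/-- The index set of the monomials `U_1 U_2 ⋯ U_n` in normal form: a choice, for each `i`, of
one of the `2 i` words that are allowed for `U_i`. -/
abbrev NormalForm (n : ℕ) : Type := (i : Fin n) → Fin (2 * i.val + 2)

/-- The word of a monomial in normal form. -/
def NormalForm.word {n : ℕ} (M : NormalForm n) : List (Fin n) :=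
  (List.finRange n).flatMap fun i => segment i (M i)

/-- The monomial in normal form, as an element of the Hecke algebra. -/
def NormalForm.monomial {n : ℕ} (M : NormalForm n) : HB n := (M.word.map b).prod

/-- The number of occurrences of `b_1`. -/
def NormalForm.countFirst {n : ℕ} (M : NormalForm n) : ℕ := M.word.countP fun i => i.val = 0

/-- The number of occurrences of `b_2, …, b_n`. -/
def NormalForm.countOther {n : ℕ} (M : NormalForm n) : ℕ := M.word.countP fun i => i.val ≠ 0

/-- Even number of `b_1`, even number of `b_2, …, b_n`. -/
def classX (n : ℕ) : Set (NormalForm n) := {M | Even M.countFirst ∧ Even M.countOther}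

/-- Odd number of `b_1`, even number of `b_2, …, b_n`. -/
def classY (n : ℕ) : Set (NormalForm n) := {M | Odd M.countFirst ∧ Even M.countOther}

/-- Even number of `b_1`, odd number of `b_2, …, b_n`. -/
def classZ (n : ℕ) : Set (NormalForm n) := {M | Even M.countFirst ∧ Odd M.countOther}

/-- Odd number of `b_1`, odd number of `b_2, …, b_n`. -/
def classW (n : ℕ) : Set (NormalForm n) := {M | Odd M.countFirst ∧ Odd M.countOther}

/-- `P = ⨁_{M ∈ C} R3 M`: the monomials in `C` form a basis of the submodule `P`. -/
def IsFreeOn {n : ℕ} (P : Submodule R3 (HB n)) (C : Set (NormalForm n)) : Prop :=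
  LinearIndependent R3 (fun M : C => M.val.monomial) ∧
    Submodule.span R3 (Set.range fun M : C => M.val.monomial) = P

end HB

/-- An `S`-graded Clifford system in the `R`-algebra `A`, which is finitely generated as a module;
`A` is then called an `S`-crossed product. -/
structure IsGradedCliffordSystem {S R A : Type} [Group S] [Finite S] [DecidableEq S] [CommRing R]
    [Ring A] [Algebra R A] (𝒜 : S → Submodule R A) : Prop where
  finite : Module.Finite R A
  mul_eq : ∀ s t : S, 𝒜 s * 𝒜 t = 𝒜 (s * t)
  exists_unit : ∀ s : S, ∃ x : Aˣ,
    𝒜 s = (𝒜 1).map (LinearMap.mulLeft R (x : A)) ∧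
    𝒜 s = (𝒜 1).map (LinearMap.mulRight R (x : A))
  isInternal : DirectSum.IsInternal 𝒜
  one_mem : (1 : A) ∈ 𝒜 1

/-- The subalgebra `B` of `A` is a `ℤ₂`-crossed product whose degree zero and degree one parts are
the submodules `P` and `Q` of `A`. -/
def IsZ2CrossedProduct {R A : Type} [CommRing R] [Ring A] [Algebra R A] (B : Subalgebra R A)
    (P Q : Submodule R A) : Prop :=
  ∃ 𝒜 : Multiplicative (ZMod 2) → Submodule R B,
    IsGradedCliffordSystem 𝒜 ∧
    (𝒜 (Multiplicative.ofAdd 0)).map B.val.toLinearMap = P ∧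
    (𝒜 (Multiplicative.ofAdd 1)).map B.val.toLinearMap = Q

end

/-! The elements `b_i` are affine rescalings of the `a_i` chosen so that all three involutions act
on them by signs: `♯` negates only `b_1`, `♭` negates all the others, and `♮ = ♯♭` negates every
`b_i`. A monomial in the `b_i` is therefore a common eigenvector of `♯` and `♭`, with eigenvalues
given by the parities of its two letter counts. If the normal-form monomials are a basis of the
algebra, then each common eigenspace is free on one of the four parity classes (`isFreeOn_eigen`),
and the rest is formal because 2 is invertible.

The basis property is the substantial part. In the `b_i` the relations become `b_i² = 1`, the
unchanged length-four braid relation, commutation, and a length-three braid relation with a linear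
error term `κ (b_{i+1} - b_i)`. Normal forms span by induction on the rank: with `H_m` generated by
the first `m` generators and `π_m` the palindrome `β_m ⋯ β_0 ⋯ β_m`, one has `H_{m+1} = H_m + H_m
β_m H_m + H_m π_m` (`initial_succ_le`), as for double cosets in the Weyl group of type `B`.

For independence the algebra acts on the free module on integer words, by the usual Hecke action on
adjacent letters and by the sign change of the first letter. Applied to a word whose letters and
their negatives are distinct, the segments of the last factor bring different signed letters to
position `m`, up to terms with earlier ones, while `H_m` leaves that position alone. This is a
triangular system, solved by induction (`IsReflecting.linearIndependent`).

Finally, conjugation by `b_1` permutes the set of the `b̄_i`, so all `b_1` in a monomial can be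
moved to the right; this identifies the subalgebra `†` with the common fixed space (`dagger_eq`).
Each fixed subalgebra splits into the two eigenspaces of a second involution, and `b_2`, `b_1` and
`b_1 b_2` are the units of odd degree that make these splittings crossed products
(`isZ2CrossedProduct_of_involution`). -/

/-- The relations of type `B` in terms of generators that square to one. -/
structure InvolutiveRelations {R A : Type} [CommRing R] [Ring A] [Algebra R A] (N : ℕ) (κ : R)
    (β : ℕ → A) : Prop where
  sq : ∀ i, i < N → β i * β i = 1
  four : 1 < N → β 0 * β 1 * β 0 * β 1 = β 1 * β 0 * β 1 * β 0
  three : ∀ i, 0 < i → i + 1 < N →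
    β i * β (i + 1) * β i = β (i + 1) * β i * β (i + 1) + κ • (β (i + 1) - β i)
  comm : ∀ i j, i + 1 < j → j < N → Commute (β i) (β j)

/-- Only right multiplication by generators has to be checked, so `L` need not be known to be a
subalgebra. -/
theorem adjoin_le_of_mul_mem {R A : Type} [CommRing R] [Ring A] [Algebra R A] {s : Set A}
    {L : Submodule R A} (h1 : 1 ∈ L) (h : ∀ x ∈ L, ∀ y ∈ s, x * y ∈ L) :
    Subalgebra.toSubmodule (Algebra.adjoin R s) ≤ L := by
  rw [Algebra.adjoin_eq_span, Submodule.span_le]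
  intro x hx
  induction hx using Submonoid.closure_induction_right with
  | one => exact h1
  | mul_right x hx y hy ih => exact h x ih y hy

/-! ### Spanning: double cosets and reduction to normal form. -/

namespace InvolutiveRelations

section Span

variable {R A : Type} [CommRing R] [Ring A] [Algebra R A]

/-- The subalgebra generated by the first `m` generators. -/
def initial (R : Type) {A : Type} [CommRing R] [Ring A] [Algebra R A] (β : ℕ → A) (m : ℕ) :
    Subalgebra R A :=
  Algebra.adjoin R {x | ∃ i, i < m ∧ x = β i}

/-- The palindrome `β_m ⋯ β_1 β_0 β_1 ⋯ β_m`. -/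
def palindrome (β : ℕ → A) : ℕ → A
  | 0 => β 0
  | m + 1 => β (m + 1) * palindrome β m * β (m + 1)

/-- The span of the double cosets of `1`, `β_m` and the palindrome with respect to the
subalgebra generated by the first `m` generators. -/
def cosetSpan (R : Type) {A : Type} [CommRing R] [Ring A] [Algebra R A] (β : ℕ → A) (m : ℕ) :
    Submodule R A :=
  Submodule.span R ({x | x ∈ initial R β m} ∪
    {x | ∃ h ∈ initial R β m, ∃ h' ∈ initial R β m, x = h * β m * h'} ∪
    {x | ∃ h ∈ initial R β m, x = h * palindrome β m})

variable {β : ℕ → A} {m : ℕ}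

theorem gen_mem_initial {i : ℕ} (hi : i < m) : β i ∈ initial R β m :=
  Algebra.subset_adjoin ⟨i, hi, rfl⟩

theorem initial_mono {k : ℕ} (h : k ≤ m) : initial R β k ≤ initial R β m :=
  Algebra.adjoin_mono fun _ ⟨i, hi, hx⟩ => ⟨i, hi.trans_le h, hx⟩

theorem palindrome_mem_initial : palindrome β m ∈ initial R β (m + 1) := by
  induction m with
  | zero => exact gen_mem_initial (Nat.lt_succ_self 0)
  | succ m ih =>
    have h : β (m + 1) ∈ initial R β (m + 1 + 1) := gen_mem_initial (Nat.lt_succ_self _)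
    exact mul_mem (mul_mem h (initial_mono (Nat.le_succ _) ih)) h

theorem commute_of_mem_initial {x y : A} (h : ∀ i, i < m → Commute (β i) y)
    (hx : x ∈ initial R β m) : Commute x y := by
  have hle : initial R β m ≤ Subalgebra.centralizer R {y} := by
    refine Algebra.adjoin_le ?_
    rintro x ⟨i, hi, rfl⟩
    rw [SetLike.mem_coe, Subalgebra.mem_centralizer_iff]
    rintro z rfl
    exact (h i hi).symm
  exact ((Subalgebra.mem_centralizer_iff R).1 (hle hx) y rfl).symm

theorem initial_zero : initial R β 0 = ⊥ := by
  simp [initial]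

theorem mem_cosetSpan_of_mem {x : A} (hx : x ∈ initial R β m) : x ∈ cosetSpan R β m :=
  Submodule.subset_span (Or.inl (Or.inl hx))

theorem mul_gen_mul_mem {h h' : A} (hh : h ∈ initial R β m) (hh' : h' ∈ initial R β m) :
    h * β m * h' ∈ cosetSpan R β m :=
  Submodule.subset_span (Or.inl (Or.inr ⟨h, hh, h', hh', rfl⟩))

theorem mul_palindrome_mem {h : A} (hh : h ∈ initial R β m) :
    h * palindrome β m ∈ cosetSpan R β m :=
  Submodule.subset_span (Or.inr ⟨h, hh, rfl⟩)

theorem cosetSpan_le {P : Submodule R A} (h1 : ∀ x ∈ initial R β m, x ∈ P)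
    (h2 : ∀ h ∈ initial R β m, ∀ h' ∈ initial R β m, h * β m * h' ∈ P)
    (h3 : ∀ h ∈ initial R β m, h * palindrome β m ∈ P) : cosetSpan R β m ≤ P := by
  refine Submodule.span_le.2 ?_
  rintro x ((hx | ⟨h, hh, h', hh', rfl⟩) | ⟨h, hh, rfl⟩)
  exacts [h1 x hx, h2 h hh h' hh', h3 h hh]

theorem mul_mem_cosetSpan {g x : A} (hg : g ∈ initial R β m) (hx : x ∈ cosetSpan R β m) :
    g * x ∈ cosetSpan R β m := by
  have : cosetSpan R β m ≤ (cosetSpan R β m).comap (LinearMap.mulLeft R g) := by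
    refine cosetSpan_le (fun x hx => ?_) (fun h hh h' hh' => ?_) (fun h hh => ?_)
    · exact mem_cosetSpan_of_mem (mul_mem hg hx)
    · simpa [mul_assoc] using mul_gen_mul_mem (mul_mem hg hh) hh'
    · simpa [mul_assoc] using mul_palindrome_mem (mul_mem hg hh)
  exact this hx

variable {N : ℕ} {κ : R}

/-- The coset span is everything as soon as it is stable under the two nontrivial operations. -/
theorem initial_succ_le_of (hm : β m * β m = 1)
    (hconj : ∀ h ∈ initial R β m, β m * h * β m ∈ cosetSpan R β m)
    (hpal : palindrome β m * β m ∈ cosetSpan R β m)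
    (hgen : ∀ j, j < m → palindrome β m * β j ∈ cosetSpan R β m) :
    Subalgebra.toSubmodule (initial R β (m + 1)) ≤ cosetSpan R β m := by
  refine adjoin_le_of_mul_mem (mem_cosetSpan_of_mem (one_mem _)) ?_
  rintro x hx _ ⟨j, hj, rfl⟩
  have : cosetSpan R β m ≤ (cosetSpan R β m).comap (LinearMap.mulRight R (β j)) := by
    rcases Nat.lt_succ_iff_lt_or_eq.1 hj with hj | rfl
    · refine cosetSpan_le (fun x hx => ?_) (fun h hh h' hh' => ?_) (fun h hh => ?_)
      · exact mem_cosetSpan_of_mem (mul_mem hx (gen_mem_initial hj))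
      · simpa [mul_assoc] using mul_gen_mul_mem hh (mul_mem hh' (gen_mem_initial hj))
      · simpa [mul_assoc] using mul_mem_cosetSpan hh (hgen j hj)
    · refine cosetSpan_le (fun x hx => ?_) (fun h hh h' hh' => ?_) (fun h hh => ?_)
      · simpa using mul_gen_mul_mem hx (one_mem _)
      · simpa [mul_assoc] using mul_mem_cosetSpan hh (hconj h' hh')
      · simpa [mul_assoc] using mul_mem_cosetSpan hh hpal
  exact this hx

theorem commute_gen_of_mem (hβ : InvolutiveRelations N κ β) (hm : m + 1 < N) {h : A}
    (hh : h ∈ initial R β m) : Commute h (β (m + 1)) :=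
  commute_of_mem_initial (fun i hi => hβ.comm i (m + 1) (by omega) hm) hh

/-- The deformed braid relation trades `β_{m+1} β_m β_{m+1}` for `β_m β_{m+1} β_m`, which has a
single `β_{m+1}`, at the cost of linear terms that have at most one. -/
theorem braid_mem (hβ : InvolutiveRelations N κ β) (hm0 : 0 < m) (hm : m + 1 < N) {f g : A}
    (hf : f ∈ initial R β (m + 1)) (hg : g ∈ initial R β (m + 1)) :
    f * (β (m + 1) * β m * β (m + 1)) * g ∈ cosetSpan R β (m + 1) := by
  have hx : β m ∈ initial R β (m + 1) := gen_mem_initial (Nat.lt_succ_self _)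
  have key : f * (β (m + 1) * β m * β (m + 1)) * g
      = (f * β m) * β (m + 1) * (β m * g) - κ • (f * β (m + 1) * g) + κ • (f * β m * g) := by
    have h := hβ.three m hm0 hm
    rw [eq_comm, ← eq_sub_iff_add_eq] at h
    rw [h]
    simp only [mul_sub, sub_mul, smul_sub, mul_smul_comm, smul_mul_assoc, mul_assoc]
    abel
  rw [key]
  refine add_mem (sub_mem (mul_gen_mul_mem (mul_mem hf hx) (mul_mem hx hg)) ?_) ?_
  · exact Submodule.smul_mem _ _ (mul_gen_mul_mem hf hg)
  · exact Submodule.smul_mem _ _ (mem_cosetSpan_of_mem (mul_mem (mul_mem hf hx) hg))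

/-- The decomposition of `H_{m+1}` one rank lower reduces `h` to three shapes. Elements of `H_m`
commute with `β_{m+1}`, so conjugation fixes them, turns `β_m` into a braid word, and turns `π_m`
into `π_{m+1}`. -/
theorem conj_mem (hβ : InvolutiveRelations N κ β) (hm : m + 1 < N)
    (ih : Subalgebra.toSubmodule (initial R β (m + 1)) ≤ cosetSpan R β m) {h : A}
    (hh : h ∈ initial R β (m + 1)) :
    β (m + 1) * h * β (m + 1) ∈ cosetSpan R β (m + 1) := by
  have hsq := hβ.sq (m + 1) hm
  have hsub : ∀ {g}, g ∈ initial R β m → g ∈ initial R β (m + 1) :=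
    fun hg => initial_mono (Nat.le_succ _) hg
  have : cosetSpan R β m ≤ (cosetSpan R β (m + 1)).comap
      (LinearMap.mulLeft R (β (m + 1)) ∘ₗ LinearMap.mulRight R (β (m + 1))) := by
    refine cosetSpan_le (fun x hx => ?_) (fun h hh h' hh' => ?_) (fun h hh => ?_)
    · have hc := commute_gen_of_mem hβ hm hx
      simp only [Submodule.mem_comap, LinearMap.comp_apply, LinearMap.mulLeft_apply,
        LinearMap.mulRight_apply]
      rw [hc.eq, ← mul_assoc, hsq, one_mul]
      exact mem_cosetSpan_of_mem (hsub hx)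
    · have hc := commute_gen_of_mem hβ hm hh
      have hc' := commute_gen_of_mem hβ hm hh'
      simp only [Submodule.mem_comap, LinearMap.comp_apply, LinearMap.mulLeft_apply,
        LinearMap.mulRight_apply]
      have e : β (m + 1) * (h * β m * h' * β (m + 1))
          = h * (β (m + 1) * β m * β (m + 1)) * h' := by
        rw [mul_assoc _ h' _, hc'.eq]
        simp only [← mul_assoc]
        rw [← hc.eq]
      rw [e]
      -- The length-three relation does not cover `β_0` and `β_1`. In that case `H_0` consists of
      -- scalars and `β_1 β_0 β_1` is itself the palindrome.
      rcases Nat.eq_zero_or_pos m with rfl | hm0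
      · rw [initial_zero] at hh'
        obtain ⟨r, rfl⟩ := Algebra.mem_bot.1 hh'
        rw [← Algebra.commutes]
        rw [← mul_assoc]
        exact mul_palindrome_mem (mul_mem (Subalgebra.algebraMap_mem _ r) (hsub hh))
      · exact braid_mem hβ hm0 hm (hsub hh) (hsub hh')
    · have hc := commute_gen_of_mem hβ hm hh
      simp only [Submodule.mem_comap, LinearMap.comp_apply, LinearMap.mulLeft_apply,
        LinearMap.mulRight_apply]
      have e : β (m + 1) * (h * palindrome β m * β (m + 1)) = h * palindrome β (m + 1) := by
        simp only [palindrome, ← mul_assoc]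
        rw [← hc.eq]
      rw [e]
      exact mul_palindrome_mem (hsub hh)
  simpa [mul_assoc] using this (ih hh)

/-- In the Weyl group the palindrome is the sign change of one coordinate, which commutes with the
earlier generators. Here it commutes with `β_m` up to terms of the first two kinds in the coset
span. -/
theorem palindrome_mul_gen_mem (hβ : InvolutiveRelations N κ β) (hm : m + 1 < N) :
    palindrome β (m + 1) * β m ∈ cosetSpan R β (m + 1) := by
  have hx : β m ∈ initial R β (m + 1) := gen_mem_initial (Nat.lt_succ_self _)
  cases m with
  | zero =>
    have h : palindrome β (0 + 1) * β 0 = β 0 * palindrome β (0 + 1) := by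
      simpa [palindrome, mul_assoc] using (hβ.four hm).symm
    rw [h]
    exact mul_palindrome_mem hx
  | succ p =>
    have h3 := hβ.three (p + 1) (Nat.succ_pos p) hm
    have hf1 : palindrome β p ∈ initial R β (p + 1) := palindrome_mem_initial
    have hf : palindrome β p ∈ initial R β (p + 1 + 1) := initial_mono (Nat.le_succ _) hf1
    have hc : Commute (palindrome β p) (β (p + 1 + 1)) := commute_gen_of_mem hβ hm hf1
    have hb : ∀ {g g' : A}, g ∈ initial R β (p + 1 + 1) → g' ∈ initial R β (p + 1 + 1) →
        g * (β (p + 1 + 1) * β (p + 1) * β (p + 1 + 1)) * g' ∈ cosetSpan R β (p + 1 + 1) :=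
      fun hg hg' => braid_mem hβ (Nat.succ_pos p) hm hg hg'
    have hpal : ∀ h ∈ initial R β (p + 1 + 1),
        h * palindrome β (p + 1 + 1) ∈ cosetSpan R β (p + 1 + 1) := fun h hh => mul_palindrome_mem hh
    simp only [palindrome] at hpal ⊢
    generalize palindrome β p = f at *
    generalize β (p + 1) = x at *
    have hg : ∀ {g g' : A}, g ∈ initial R β (p + 1 + 1) → g' ∈ initial R β (p + 1 + 1) →
        g * β (p + 1 + 1) * g' ∈ cosetSpan R β (p + 1 + 1) := fun h h' => mul_gen_mul_mem h h'
    generalize β (p + 1 + 1) = y at *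
    -- Since `f` commutes with `y`, the undeformed computation is `yxf(xyx) = yxf(yxy) = (yxy)fxy =
    -- (xyx)fxy = x(yxfxy)`. The deformed relation is used twice, and each use contributes two of
    -- the four `κ` terms.
    have key : y * (x * f * x) * y * x = x * (y * (x * f * x) * y)
        - κ • (f * (y * x * y) * 1) + κ • ((x * f * x) * y * 1) + κ • (1 * (y * x * y) * f)
        - κ • (1 * y * (x * f * x)) := by
      have e1 : y * (x * f * x) * y * x = y * x * f * (x * y * x) := by noncomm_ring
      have e2 : y * x * f * (y * x * y) = (y * x * y) * f * (x * y) := by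
        have : y * x * f * (y * x * y) = y * x * (f * y) * x * y := by noncomm_ring
        rw [this, hc.eq]; noncomm_ring
      have e3 : y * x * f * y = y * x * y * f := by
        rw [mul_assoc _ f y, hc.eq]; noncomm_ring
      have e4 : y * f * (x * y) = f * (y * x * y) := by
        rw [← hc.eq]; noncomm_ring
      have e5 : y * x * y = x * y * x - κ • (y - x) := by rw [h3]; abel
      rw [e1, h3, mul_add, e2]
      nth_rewrite 1 [e5]
      simp only [sub_mul, mul_smul_comm, smul_mul_assoc, mul_sub, smul_sub, e3, e4, one_mul,
        mul_one]
      simp only [mul_assoc]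
      abel
    rw [key]
    have hxfx := mul_mem (mul_mem hx hf) hx
    refine sub_mem (add_mem (add_mem (sub_mem (hpal x hx) ?_) ?_) ?_) ?_ <;>
      refine Submodule.smul_mem _ _ ?_
    · exact hb hf (one_mem _)
    · exact hg hxfx (one_mem _)
    · exact hb (one_mem _) hf
    · exact hg (one_mem _) hxfx

/-- By induction on `m`, since `conj_mem` at one rank needs the decomposition at the previous one.
For `j` at least two below the top generator, `β_j` slides inside the outer pair of the palindrome
and `conj_mem` applies again. -/
theorem initial_succ_le (hβ : InvolutiveRelations N κ β) (hm : m < N) :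
    Subalgebra.toSubmodule (initial R β (m + 1)) ≤ cosetSpan R β m := by
  induction m with
  | zero =>
    refine initial_succ_le_of (hβ.sq 0 hm) (fun h hh => ?_) ?_ (fun j hj => ?_)
    · rw [initial_zero] at hh
      obtain ⟨r, rfl⟩ := Algebra.mem_bot.1 hh
      rw [← Algebra.commutes, mul_assoc, hβ.sq 0 hm]
      exact mem_cosetSpan_of_mem (mul_mem (Subalgebra.algebraMap_mem _ r) (one_mem _))
    · rw [palindrome, hβ.sq 0 hm]
      exact mem_cosetSpan_of_mem (one_mem _)
    · omega
  | succ m ih =>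
    have ih := ih (by omega)
    refine initial_succ_le_of (hβ.sq _ hm) (fun h hh => conj_mem hβ hm ih hh) ?_ (fun j hj => ?_)
    · rw [palindrome, mul_assoc, hβ.sq _ hm, mul_one]
      simpa using mul_gen_mul_mem (β := β) (R := R) (one_mem _) palindrome_mem_initial
    · rcases Nat.lt_succ_iff_lt_or_eq.1 hj with hj | rfl
      · have hc : Commute (β j) (β (m + 1)) := hβ.comm j (m + 1) (by omega) hm
        rw [palindrome, mul_assoc, ← hc.eq, ← mul_assoc, mul_assoc (β (m + 1))]
        exact conj_mem hβ hm ih (mul_mem palindrome_mem_initial (gen_mem_initial (by omega)))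
      · exact palindrome_mul_gen_mem hβ hm

/-- The letter at position `j` of the word `m, m - 1, …, 1, 0, 1, …, m - 1, m`. -/
def letter (m j : ℕ) : ℕ := if j ≤ m then m - j else j - m

/-- The first `k` letters of the word `m, m - 1, …, 1, 0, 1, …, m - 1, m`. -/
def segmentWord (m k : ℕ) : List ℕ := (List.range k).map (letter m)

/-- The word, with letters in `ℕ`, of a monomial in normal form. -/
def normalWord {m : ℕ} (M : HB.NormalForm m) : List ℕ :=
  (List.finRange m).flatMap fun i => segmentWord i.val (M i).val

theorem segmentWord_succ (m k : ℕ) : segmentWord m (k + 1) = segmentWord m k ++ [letter m k] := by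
  simp [segmentWord, List.range_succ]

theorem segmentWord_succ_succ (m k : ℕ) :
    segmentWord (m + 1) (k + 1) = (m + 1) :: segmentWord m k := by
  rw [segmentWord, List.range_succ_eq_map, List.map_cons, List.map_map, segmentWord]
  congr 1
  refine List.map_congr_left fun j _ => ?_
  simp only [letter, Function.comp_apply]
  split_ifs <;> omega

theorem prod_segmentWord_full (β : ℕ → A) (m : ℕ) :
    ((segmentWord m (2 * m + 1)).map β).prod = palindrome β m := by
  induction m with
  | zero => simp [segmentWord, letter, palindrome]
  | succ m ih =>
    have h : letter (m + 1) (2 * (m + 1)) = m + 1 := by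
      simp only [letter]
      split_ifs <;> omega
    rw [segmentWord_succ, h, Nat.mul_succ, segmentWord_succ_succ, palindrome, ← ih]
    simp [mul_assoc]

/-- Extend a normal form by one more segment. -/
def normalSnoc {m : ℕ} (M : HB.NormalForm m) (k : Fin (2 * m + 2)) : HB.NormalForm (m + 1) :=
  Fin.snoc (α := fun i : Fin (m + 1) => Fin (2 * i.val + 2)) M k

theorem normalWord_snoc {m : ℕ} (M : HB.NormalForm m) (k : Fin (2 * m + 2)) :
    normalWord (normalSnoc M k) = normalWord M ++ segmentWord m k := by
  rw [normalWord, List.finRange_succ_last, List.flatMap_append, List.flatMap_map]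
  congr 1
  · refine List.flatMap_congr fun i _ => ?_
    rw [normalSnoc, Fin.snoc_castSucc]
    rfl
  · rw [normalSnoc, List.flatMap_singleton, Fin.snoc_last]
    rfl

/-- Every element of the next subalgebra is a combination of segments. -/
theorem initial_succ_le_span_segments (hβ : InvolutiveRelations N κ β) (hm : m < N) :
    Subalgebra.toSubmodule (initial R β (m + 1)) ≤
      Submodule.span R {x | ∃ h ∈ initial R β m, ∃ k : Fin (2 * m + 2),
        x = h * ((segmentWord m k).map β).prod} := by
  induction m with
  | zero =>
    refine (initial_succ_le hβ hm).trans ?_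
    refine cosetSpan_le (fun x hx => ?_) (fun h hh h' hh' => ?_) (fun h hh => ?_)
    · exact Submodule.subset_span ⟨x, hx, 0, by simp [segmentWord]⟩
    · refine Submodule.subset_span ⟨h * h', mul_mem hh hh', 1, ?_⟩
      rw [initial_zero] at hh'
      obtain ⟨r, rfl⟩ := Algebra.mem_bot.1 hh'
      rw [mul_assoc, mul_assoc, Algebra.commutes r (List.prod _)]
      simp [segmentWord, letter]
    · exact Submodule.subset_span ⟨h, hh, 1, by simp [segmentWord, letter, palindrome]⟩
  | succ m ih =>
    refine (initial_succ_le hβ hm).trans ?_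
    refine cosetSpan_le (fun x hx => ?_) (fun h hh h' hh' => ?_) (fun h hh => ?_)
    · exact Submodule.subset_span ⟨x, hx, 0, by simp [segmentWord]⟩
    · have hle := ih (by omega)
      have key : Submodule.span R {x | ∃ h ∈ initial R β m, ∃ k : Fin (2 * m + 2),
          x = h * ((segmentWord m k).map β).prod} ≤ Submodule.comap
            (LinearMap.mulLeft R (h * β (m + 1))) (Submodule.span R
              {x | ∃ h ∈ initial R β (m + 1), ∃ k : Fin (2 * (m + 1) + 2),
                x = h * ((segmentWord (m + 1) k).map β).prod}) := by
        refine Submodule.span_le.2 ?_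
        rintro _ ⟨g, hg, k, rfl⟩
        -- The factor `g` moves left past `β_{m+1}`, and `β_{m+1}` followed by a segment of length
        -- `k` is the segment of length `k + 1` of the next rank.
        refine Submodule.subset_span ⟨h * g, mul_mem hh (initial_mono (Nat.le_succ _) hg),
          ⟨k + 1, by omega⟩, ?_⟩
        have hc := commute_gen_of_mem hβ hm hg
        rw [LinearMap.mulLeft_apply, segmentWord_succ_succ, List.map_cons, List.prod_cons,
          ← mul_assoc, ← mul_assoc, mul_assoc h, ← hc.eq, ← mul_assoc]
      exact key (hle hh')
    · refine Submodule.subset_span ⟨h, hh, ⟨2 * (m + 1) + 1, by omega⟩, ?_⟩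
      rw [prod_segmentWord_full]

/-- The monomials in normal form span. -/
theorem initial_le_span_normalWord (hβ : InvolutiveRelations N κ β) (hm : m ≤ N) :
    Subalgebra.toSubmodule (initial R β m) ≤
      Submodule.span R (Set.range fun M : HB.NormalForm m => ((normalWord M).map β).prod) := by
  induction m with
  | zero =>
    rw [initial_zero]
    intro x hx
    obtain ⟨r, rfl⟩ := Algebra.mem_bot.1 hx
    rw [Algebra.algebraMap_eq_smul_one]
    exact Submodule.smul_mem _ _ (Submodule.subset_span ⟨fun i => i.elim0, by simp [normalWord]⟩)
  | succ m ih =>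
    refine (initial_succ_le_span_segments hβ hm).trans (Submodule.span_le.2 ?_)
    rintro _ ⟨h, hh, k, rfl⟩
    have key : Submodule.span R (Set.range fun M : HB.NormalForm m =>
        ((normalWord M).map β).prod) ≤ Submodule.comap
          (LinearMap.mulRight R ((segmentWord m k).map β).prod) (Submodule.span R
            (Set.range fun M : HB.NormalForm (m + 1) => ((normalWord M).map β).prod)) := by
      refine Submodule.span_le.2 ?_
      rintro _ ⟨M, rfl⟩
      refine Submodule.subset_span ⟨normalSnoc M k, ?_⟩
      simp [normalWord_snoc]
    exact key (ih (by omega) hh)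

end Span

end InvolutiveRelations

/-! ### The representation on integer words. -/

namespace HB

/-- Infinite words in the integers. -/
abbrev IntWord : Type := ℕ → ℤ

/-- Exchange the letters at positions `i - 1` and `i`, or change the sign of the first letter
if `i = 0`. -/
def reflect (i : ℕ) (w : IntWord) : IntWord :=
  if i = 0 then fun j => if j = 0 then -w j else w j
  else fun j => w (Equiv.swap (i - 1) i j)

/-- The coefficient of `w` in the action of a generator of the Hecke algebra on `w`. -/
noncomputable def diagCoeff (i : ℕ) (w : IntWord) : R3 :=
  if i = 0 then 0 else if w (i - 1) < w i then 0 else if w i < w (i - 1) then R3.q - 1 else R3.q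

/-- The coefficient of the reflected word in the action of a generator on `w`. -/
noncomputable def offCoeff (i : ℕ) (w : IntWord) : R3 :=
  if i = 0 then 1 else if w (i - 1) < w i then 1 else if w i < w (i - 1) then R3.q else 0

/-- The action of a generator of the Hecke algebra on the free module on words. -/
noncomputable def wordAction (i : ℕ) : Module.End R3 (IntWord →₀ R3) :=
  Finsupp.linearCombination R3 fun w =>
    diagCoeff i w • Finsupp.single w 1 + offCoeff i w • Finsupp.single (reflect i w) 1

theorem wordAction_single (i : ℕ) (w : IntWord) :
    wordAction i (Finsupp.single w 1) =
      diagCoeff i w • Finsupp.single w 1 + offCoeff i w • Finsupp.single (reflect i w) 1 := by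
  rw [wordAction, Finsupp.linearCombination_single, one_smul]

theorem end_ext {f g : Module.End R3 (IntWord →₀ R3)}
    (h : ∀ w, f (Finsupp.single w 1) = g (Finsupp.single w 1)) : f = g := by
  refine Finsupp.lhom_ext' fun w => LinearMap.ext_ring ?_
  exact h w

theorem reflect_zero (w : IntWord) : reflect 0 w = fun j => if j = 0 then -w j else w j := rfl

theorem reflect_succ (i : ℕ) (w : IntWord) :
    reflect (i + 1) w = fun j => w (Equiv.swap i (i + 1) j) := rfl

theorem reflect_apply (i : ℕ) (w : IntWord) (j : ℕ) :
    reflect (i + 1) w j = if j = i then w (i + 1) else if j = i + 1 then w i else w j := by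
  simp only [reflect_succ, Equiv.swap_apply_def]
  split_ifs <;> rfl

theorem reflect_zero_apply (w : IntWord) (j : ℕ) :
    reflect 0 w j = if j = 0 then -w j else w j := rfl

theorem reflect_reflect (i : ℕ) (w : IntWord) : reflect i (reflect i w) = w := by
  cases i with
  | zero => funext j; simp only [reflect_zero]; split_ifs <;> simp
  | succ i => funext j; simp [reflect_succ]

theorem wordAction_zero_sq : wordAction 0 * wordAction 0 = 1 := by
  refine end_ext fun w => ?_
  simp [Module.End.mul_apply, wordAction_single, diagCoeff, offCoeff, reflect_reflect]

theorem wordAction_succ_sq (i : ℕ) : wordAction (i + 1) * wordAction (i + 1) =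
    (R3.q - 1) • wordAction (i + 1) + algebraMap R3 _ R3.q := by
  refine end_ext fun w => ?_
  have h1 : reflect (i + 1) w i = w (i + 1) := by simp [reflect_apply]
  have h2 : reflect (i + 1) w (i + 1) = w i := by simp [reflect_apply]
  simp only [Module.End.mul_apply, LinearMap.add_apply, LinearMap.smul_apply,
    Module.algebraMap_end_apply, wordAction_single, map_add, map_smul, reflect_reflect, diagCoeff,
    offCoeff, h1, h2, Nat.succ_ne_zero, if_false, Nat.add_sub_cancel]
  rcases lt_trichotomy (w i) (w (i + 1)) with h | h | h
  · simp only [h, h.not_gt, if_true, if_false]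
    module
  · simp only [h, lt_irrefl, if_false]
    module
  · simp only [h, h.not_gt, if_true, if_false]
    module

theorem wordAction_comm (i j : ℕ) (hij : i + 1 < j) :
    wordAction i * wordAction j = wordAction j * wordAction i := by
  obtain ⟨j, rfl⟩ : ∃ k, j = k + 1 := ⟨j - 1, by omega⟩
  refine end_ext fun w => ?_
  have hw : reflect i (reflect (j + 1) w) = reflect (j + 1) (reflect i w) := by
    funext k
    cases i with
    | zero =>
      simp only [reflect_zero_apply, reflect_apply]
      grind
    | succ i =>
      simp only [reflect_apply]
      grind
  have h1 : reflect i w j = w j := by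
    cases i with
    | zero => simp only [reflect_zero_apply]; grind
    | succ i => simp only [reflect_apply]; grind
  have h2 : reflect i w (j + 1) = w (j + 1) := by
    cases i with
    | zero => simp only [reflect_zero_apply]; grind
    | succ i => simp only [reflect_apply]; grind
  have hd : diagCoeff (j + 1) (reflect i w) = diagCoeff (j + 1) w := by
    simp only [diagCoeff, Nat.add_sub_cancel, h1, h2]
  have ho : offCoeff (j + 1) (reflect i w) = offCoeff (j + 1) w := by
    simp only [offCoeff, Nat.add_sub_cancel, h1, h2]
  have hd' : diagCoeff i (reflect (j + 1) w) = diagCoeff i w := by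
    cases i with
    | zero => simp [diagCoeff]
    | succ i =>
      simp only [diagCoeff, Nat.add_sub_cancel, reflect_apply]
      grind
  have ho' : offCoeff i (reflect (j + 1) w) = offCoeff i w := by
    cases i with
    | zero => simp [offCoeff]
    | succ i =>
      simp only [offCoeff, Nat.add_sub_cancel, reflect_apply]
      grind
  simp only [Module.End.mul_apply, wordAction_single, map_add, map_smul, hw, hd, ho, hd', ho']
  module

/-- Since `wordAction 0` merely permutes the basis, only the coefficients of `wordAction 1` matter.
They depend on comparing the first two letters, and that comparison is invariant under `(a, b) ↦
(-b, -a)`. -/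
theorem wordAction_braid_four :
    wordAction 0 * wordAction 1 * wordAction 0 * wordAction 1 =
      wordAction 1 * wordAction 0 * wordAction 1 * wordAction 0 := by
  refine end_ext fun w => ?_
  have h0 : ∀ w, wordAction 0 (Finsupp.single w 1) = Finsupp.single (reflect 0 w) 1 := by
    intro w
    simp [wordAction_single, diagCoeff, offCoeff]
  have hw : reflect 0 (reflect 1 (reflect 0 (reflect 1 w)))
      = reflect 1 (reflect 0 (reflect 1 (reflect 0 w))) := by
    funext k
    simp only [reflect_zero_apply, reflect_apply 0]
    grind
  have hd : diagCoeff 1 (reflect 0 (reflect 1 (reflect 0 w))) = diagCoeff 1 w := by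
    simp only [diagCoeff, reflect_zero_apply, reflect_apply 0]
    grind
  have ho : offCoeff 1 (reflect 0 (reflect 1 (reflect 0 w))) = offCoeff 1 w := by
    simp only [offCoeff, reflect_zero_apply, reflect_apply 0]
    grind
  have hd' : diagCoeff 1 (reflect 0 (reflect 1 w)) = diagCoeff 1 (reflect 0 w) := by
    simp only [diagCoeff, reflect_zero_apply, reflect_apply 0]
    grind
  have ho' : offCoeff 1 (reflect 0 (reflect 1 w)) = offCoeff 1 (reflect 0 w) := by
    simp only [offCoeff, reflect_zero_apply, reflect_apply 0]
    grind
  simp only [Module.End.mul_apply, h0, wordAction_single 1, map_add, map_smul, reflect_reflect,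
    hd, ho, hd', ho', hw]
  module

theorem wordAction_braid_three (i : ℕ) :
    wordAction (i + 1) * wordAction (i + 2) * wordAction (i + 1) =
      wordAction (i + 2) * wordAction (i + 1) * wordAction (i + 2) := by
  refine end_ext fun w => ?_
  have hw : reflect (i + 1) (reflect (i + 2) (reflect (i + 1) w))
      = reflect (i + 2) (reflect (i + 1) (reflect (i + 2) w)) := by
    funext k
    simp only [reflect_apply]
    grind
  have h1 : ∀ w, reflect (i + 1) w i = w (i + 1) := fun w => by simp [reflect_apply]
  have h2 : ∀ w, reflect (i + 1) w (i + 1) = w i := fun w => by simp [reflect_apply]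
  have h3 : ∀ w, reflect (i + 1) w (i + 2) = w (i + 2) := fun w => by simp [reflect_apply]
  have h4 : ∀ w, reflect (i + 2) w i = w i := fun w => by
    rw [reflect_apply, if_neg (by omega), if_neg (by omega)]
  have h5 : ∀ w, reflect (i + 2) w (i + 1) = w (i + 2) := fun w => by simp [reflect_apply]
  have h6 : ∀ w, reflect (i + 2) w (i + 2) = w (i + 1) := fun w => by simp [reflect_apply]
  simp only [Module.End.mul_apply, wordAction_single, map_add, map_smul, reflect_reflect, hw,
    diagCoeff, offCoeff, Nat.add_one_ne_zero, if_false, Nat.add_sub_cancel, h1, h2, h3, h4, h5, h6,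
    show i + 2 ≠ 0 by omega, show i + 2 - 1 = i + 1 by omega]
  -- The coefficients depend only on the relative order of the three letters, ties included;
  -- inconsistent orders are discarded.
  rcases lt_trichotomy (w i) (w (i + 1)) with h | h | h <;>
  rcases lt_trichotomy (w (i + 1)) (w (i + 2)) with h' | h' | h' <;>
  rcases lt_trichotomy (w i) (w (i + 2)) with h'' | h'' | h'' <;>
  first
  | (exfalso; omega)
  | (simp only [h, h', h'', h.not_gt, h'.not_gt, h''.not_gt, if_true, if_false, lt_irrefl]
     module)

end HB

/-! ### Linear independence by leading letters. -/

/-- Block elimination from the largest index down. Once the coefficients of later blocks vanish and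
earlier blocks lie in `Q k`, the leading part of block `k` lies in `P k ⊓ Q k = ⊥`. -/
theorem linearIndependent_of_triangular {R V ι : Type} {K : ℕ} [CommRing R] [AddCommGroup V]
    [Module R V] [Fintype ι] (v : Fin K × ι → V) (x : Fin K → ι → V) (P Q : Fin K → Submodule R V)
    (hQ : ∀ k j, j < k → ∀ i, v (j, i) ∈ Q k) (hv : ∀ k i, v (k, i) - x k i ∈ Q k)
    (hx : ∀ k i, x k i ∈ P k) (hd : ∀ k, Disjoint (P k) (Q k))
    (hli : ∀ k, LinearIndependent R (x k)) : LinearIndependent R v := by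
  rw [Fintype.linearIndependent_iff]
  intro g hg
  rw [Fintype.sum_prod_type] at hg
  suffices h : ∀ k, ∀ i, g (k, i) = 0 from fun p => h p.1 p.2
  intro k
  induction k using WellFoundedGT.induction with
  | ind k ih =>
    refine Fintype.linearIndependent_iff.1 (hli k) (fun i => g (k, i)) ?_
    refine Submodule.disjoint_def.1 (hd k) _
      (Submodule.sum_mem _ fun i _ => Submodule.smul_mem _ _ (hx k i)) ?_
    have hsum : ∑ i, g (k, i) • v (k, i) ∈ Q k := by
      rw [← Finset.add_sum_erase _ _ (Finset.mem_univ k)] at hg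
      rw [eq_neg_of_add_eq_zero_left hg]
      refine neg_mem (Submodule.sum_mem _ fun j hj => Submodule.sum_mem _ fun i _ => ?_)
      rcases lt_or_gt_of_ne (Finset.ne_of_mem_erase hj) with h | h
      · exact Submodule.smul_mem _ _ (hQ k j h i)
      · rw [ih j h i, zero_smul]
        exact zero_mem _
    have hdiff : ∑ i, g (k, i) • (v (k, i) - x k i) ∈ Q k :=
      Submodule.sum_mem _ fun i _ => Submodule.smul_mem _ _ (hv k i)
    have h := sub_mem hsum hdiff
    simpa [smul_sub] using h

namespace HB

/-- The letters of the word and their negatives are pairwise distinct. -/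
def IsGeneric (w : IntWord) : Prop := Function.Injective w ∧ ∀ i j, w i ≠ -w j

theorem IsGeneric.reflect {w : IntWord} (hw : IsGeneric w) (i : ℕ) : IsGeneric (reflect i w) := by
  obtain ⟨h1, h2⟩ := hw
  cases i with
  | succ i =>
    exact ⟨h1.comp (Equiv.injective _), fun j k => h2 _ _⟩
  | zero =>
    refine ⟨fun j k h => ?_, fun j k h => ?_⟩
    · simp only [reflect_zero_apply] at h
      split_ifs at h with hj hk hk
      · omega
      · exact absurd h.symm (h2 _ _)
      · exact absurd h (h2 _ _)
      · exact h1 h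
    · simp only [reflect_zero_apply] at h
      have h0 := h2 j k
      have h0' := h2 k j
      have hjj := h2 j j
      have h1' := @h1 j k
      split_ifs at h <;> grind

/-- A family of operators on the free module on words, each of which sends a word to a
combination of itself and its reflection. -/
structure IsReflecting (B : ℕ → Module.End R3 (IntWord →₀ R3)) : Prop where
  exists_eq : ∀ i w, ∃ d o : R3, (IsGeneric w → IsUnit o) ∧
    B i (Finsupp.single w 1) = d • Finsupp.single w 1 + o • Finsupp.single (reflect i w) 1

/-- The span of the words whose letter at position `m` lies in `S`. -/
noncomputable def letterSpan (m : ℕ) (S : Set ℤ) : Submodule R3 (IntWord →₀ R3) :=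
  Finsupp.supported R3 R3 {w | w m ∈ S}

theorem single_mem_letterSpan {m : ℕ} {S : Set ℤ} {w : IntWord} (h : w m ∈ S) :
    Finsupp.single w (1 : R3) ∈ letterSpan m S :=
  Finsupp.single_mem_supported R3 1 h

theorem letterSpan_mono {m : ℕ} {S T : Set ℤ} (h : S ⊆ T) : letterSpan m S ≤ letterSpan m T :=
  Finsupp.supported_mono fun _ hw => h hw

theorem reflect_apply_of_lt {i m : ℕ} (h : i < m) (w : IntWord) : reflect i w m = w m := by
  cases i with
  | zero => rw [reflect_zero_apply, if_neg (by omega)]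
  | succ i => rw [reflect_apply, if_neg (by omega), if_neg (by omega)]

variable {B : ℕ → Module.End R3 (IntWord →₀ R3)}

theorem IsReflecting.apply_mem (hB : IsReflecting B) {i m : ℕ} (hi : i < m) {S : Set ℤ}
    {x : IntWord →₀ R3} (hx : x ∈ letterSpan m S) : B i x ∈ letterSpan m S := by
  have hle : letterSpan m S ≤ (letterSpan m S).comap (B i) := by
    conv_lhs => rw [letterSpan, Finsupp.supported_eq_span_single]
    refine Submodule.span_le.2 ?_
    rintro _ ⟨w, hw, rfl⟩
    obtain ⟨d, o, -, h⟩ := hB.exists_eq i w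
    rw [SetLike.mem_coe, Submodule.mem_comap, h]
    refine add_mem (Submodule.smul_mem _ _ (single_mem_letterSpan hw))
      (Submodule.smul_mem _ _ (single_mem_letterSpan ?_))
    rwa [reflect_apply_of_lt hi]
  exact hle hx

theorem IsReflecting.prod_apply_mem (hB : IsReflecting B) {m : ℕ} {S : Set ℤ} {l : List ℕ}
    (hl : ∀ i ∈ l, i < m) {x : IntWord →₀ R3} (hx : x ∈ letterSpan m S) :
    (l.map B).prod x ∈ letterSpan m S := by
  induction l with
  | nil => simpa using hx
  | cons i l ih =>
    rw [List.map_cons, List.prod_cons, Module.End.mul_apply]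
    exact hB.apply_mem (hl i List.mem_cons_self) (ih fun j hj => hl j (List.mem_cons_of_mem _ hj))

open InvolutiveRelations

theorem lt_of_mem_normalWord {m : ℕ} {M : NormalForm m} {i : ℕ} (hi : i ∈ normalWord M) :
    i < m := by
  simp only [normalWord, List.mem_flatMap, segmentWord, List.mem_map, List.mem_range] at hi
  obtain ⟨j, -, k, hk, rfl⟩ := hi
  have := (M j).isLt
  have := j.isLt
  simp only [letter]
  split_ifs <;> omega

/-- The sequence `w m, …, w 0, -w 0, …, -w m`. -/
def entry (m j : ℕ) (w : IntWord) : ℤ := if j ≤ m then w (m - j) else -w (j - m - 1)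

/-- The first `k` terms of the sequence `w m, …, w 0, -w 0, …, -w m`. -/
def entrySet (m k : ℕ) (w : IntWord) : Set ℤ := {e | ∃ j, j < k ∧ e = entry m j w}

theorem entrySet_mono {m k l : ℕ} (h : k ≤ l) (w : IntWord) : entrySet m k w ⊆ entrySet m l w :=
  fun _ ⟨j, hj, he⟩ => ⟨j, hj.trans_le h, he⟩

theorem entry_notMem_entrySet {w : IntWord} (hw : IsGeneric w) (m k : ℕ) :
    entry m k w ∉ entrySet m k w := by
  rintro ⟨j, hj, h⟩
  obtain ⟨h1, h2⟩ := hw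
  simp only [entry] at h
  split_ifs at h with hk hj' hj'
  · have := h1 h
    omega
  · omega
  · exact h2 _ _ h.symm
  · have := h1 (neg_injective h)
    omega

/-- The `k`-th letter of the segment word acts on the sequence `w m, …, w 0, -w 0, …, -w m` by
exchanging its adjacent terms number `k` and `k + 1`. -/
theorem entry_reflect {m k : ℕ} (hk : k ≤ 2 * m) (w : IntWord) :
    entry m k (reflect (letter m k) w) = entry m (k + 1) w := by
  rcases lt_trichotomy k m with h | rfl | h
  · obtain ⟨p, hp⟩ : ∃ p, m = k + (p + 1) := ⟨m - k - 1, by omega⟩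
    have e : letter m k = p + 1 := by rw [letter, if_pos h.le]; omega
    have e1 : m - k = p + 1 := by omega
    have e2 : m - (k + 1) = p := by omega
    rw [e, entry, entry, if_pos h.le, if_pos (by omega), reflect_apply, e1, e2]
    simp
  · simp [letter, entry, reflect_zero_apply]
  · obtain ⟨p, hp⟩ : ∃ p, k = m + (p + 1) := ⟨k - m - 1, by omega⟩
    have e : letter m k = p + 1 := by rw [letter, if_neg (by omega)]; omega
    have e1 : k - m - 1 = p := by omega
    have e2 : k + 1 - m - 1 = p + 1 := by omega
    rw [e, entry, entry, if_neg (by omega), if_neg (by omega), reflect_apply, e1, e2]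
    simp

/-- For `k ≤ m` the first `k` terms are untouched. For `k > m` the mirror image of the exchange
swaps terms `2m - k` and `2m + 1 - k`, both among the first `k`, so the set is preserved. -/
theorem entrySet_reflect_subset {m k : ℕ} (hk : k ≤ 2 * m) (w : IntWord) :
    entrySet m k (reflect (letter m k) w) ⊆ entrySet m k w := by
  rintro _ ⟨j, hj, rfl⟩
  rcases lt_trichotomy k m with h | rfl | h
  · refine ⟨j, hj, ?_⟩
    have e : letter m k = m - k := by rw [letter, if_pos h.le]
    rw [e, entry, entry, if_pos (by omega), if_pos (by omega), reflect_apply_of_lt (by omega)]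
  · refine ⟨j, hj, ?_⟩
    have e : letter k k = 0 := by simp [letter]
    rw [e, entry, entry, if_pos (by omega), if_pos (by omega), reflect_apply_of_lt (by omega)]
  · obtain ⟨p, hp⟩ : ∃ p, k = m + (p + 1) := ⟨k - m - 1, by omega⟩
    have e : letter m k = p + 1 := by rw [letter, if_neg (by omega)]; omega
    rw [e]
    by_cases hjm : j ≤ m
    · by_cases h1 : m - j = p
      · refine ⟨j - 1, by omega, ?_⟩
        rw [entry, entry, if_pos hjm, if_pos (by omega), reflect_apply, if_pos h1]
        congr 1
        omega
      · by_cases h2 : m - j = p + 1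
        · refine ⟨j + 1, by omega, ?_⟩
          rw [entry, entry, if_pos hjm, if_pos (by omega), reflect_apply, if_neg h1, if_pos h2]
          congr 1
          omega
        · refine ⟨j, hj, ?_⟩
          rw [entry, entry, if_pos hjm, if_pos (by omega), reflect_apply, if_neg h1, if_neg h2]
    · refine ⟨j, hj, ?_⟩
      rw [entry, entry, if_neg hjm, if_neg hjm, reflect_apply, if_neg (by omega),
        if_neg (by omega)]

/-- The rightmost letter acts first and yields a multiple of `w` and a unit multiple of its
reflection. The rest of the segment sends `w` to words with earlier entries at position `m`, while
the reflected word supplies the new leading entry. -/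
theorem IsReflecting.segment_apply (hB : IsReflecting B) {m k : ℕ} (hk : k ≤ 2 * m + 1)
    {w : IntWord} (hw : IsGeneric w) :
    ∃ (u : R3ˣ) (w' : IntWord), IsGeneric w' ∧ w' m = entry m k w ∧
      ((segmentWord m k).map B).prod (Finsupp.single w 1) - (u : R3) • Finsupp.single w' 1
        ∈ letterSpan m (entrySet m k w) := by
  induction k generalizing w with
  | zero =>
    refine ⟨1, w, hw, by simp [entry], ?_⟩
    simp [segmentWord]
  | succ k ih =>
    obtain ⟨d, o, ho, h⟩ := hB.exists_eq (letter m k) w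
    obtain ⟨v, hv⟩ := ho hw
    obtain ⟨u, w', -, hw', hmem⟩ := ih (by omega) hw
    obtain ⟨u₂, w₂, hg₂, hw₂, hmem₂⟩ := ih (by omega) (hw.reflect (letter m k))
    refine ⟨v * u₂, w₂, hg₂, hw₂.trans (entry_reflect (by omega) w), ?_⟩
    rw [segmentWord_succ, List.map_append, List.prod_append, List.map_singleton,
      List.prod_singleton, Module.End.mul_apply, h, map_add, map_smul, map_smul, Units.val_mul,
      hv, mul_smul, add_sub_assoc, ← smul_sub]
    refine add_mem (Submodule.smul_mem _ _ ?_) (Submodule.smul_mem _ _ ?_)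
    · rw [← sub_add_cancel (((segmentWord m k).map B).prod _) ((u : R3) • Finsupp.single w' 1)]
      refine add_mem (letterSpan_mono (entrySet_mono (Nat.le_succ k) w) hmem) ?_
      exact Submodule.smul_mem _ _ (single_mem_letterSpan ⟨k, Nat.lt_succ_self k, hw'⟩)
    · exact letterSpan_mono ((entrySet_reflect_subset (by omega) w).trans
        (entrySet_mono (Nat.le_succ k) w)) hmem₂

theorem IsReflecting.linearIndependent (hB : IsReflecting B) (m : ℕ) {w : IntWord}
    (hw : IsGeneric w) :
    LinearIndependent R3 fun M : NormalForm m =>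
      ((normalWord M).map B).prod (Finsupp.single w 1) := by
  induction m generalizing w with
  | zero =>
    have : Unique (NormalForm 0) := inferInstanceAs (Unique ((i : Fin 0) → Fin (2 * i.val + 2)))
    rw [Fintype.linearIndependent_iff]
    intro g hg i
    have h : ∀ M : NormalForm 0, normalWord M = [] := fun M => by simp [normalWord]
    rw [Fintype.sum_unique, h, List.map_nil, List.prod_nil, Module.End.one_apply,
      Finsupp.smul_single_one, Finsupp.single_eq_zero] at hg
    exact (congrArg g (Subsingleton.elim i _)).trans hg
  | succ m ih =>
    refine (linearIndependent_equiv
      (Fin.snocEquiv fun i : Fin (m + 1) => Fin (2 * i.val + 2))).1 ?_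
    choose! u w' hg hw' hmem using fun k : Fin (2 * m + 2) =>
      hB.segment_apply (m := m) (k := k) (by omega) hw
    have hword : ∀ p : Fin (2 * m + 2) × NormalForm m,
        ((normalWord (normalSnoc p.2 p.1)).map B).prod (Finsupp.single w 1) =
          ((normalWord p.2).map B).prod (((segmentWord m p.1).map B).prod (Finsupp.single w 1)) := by
      intro p
      rw [normalWord_snoc, List.map_append, List.prod_append, Module.End.mul_apply]
    change LinearIndependent R3 fun p : Fin (2 * m + 2) × NormalForm m =>
        ((normalWord (normalSnoc p.2 p.1)).map B).prod (Finsupp.single w 1)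
    simp only [hword]
    -- Blocks are indexed by the length `k` of the last segment. `P k` fixes the letter at position
    -- `m` to be the `k`-th entry, `Q k` allows only earlier entries, and the remaining factors do
    -- not move that position. Within a block, induction is applied to the leading word `w' k`.
    refine linearIndependent_of_triangular _
      (fun k M => ((normalWord M).map B).prod ((u k : R3) • Finsupp.single (w' k) 1))
      (fun k => letterSpan m {entry m k w}) (fun k => letterSpan m (entrySet m k w))
      (fun k j hj M => ?_) (fun k M => ?_) (fun k M => ?_) (fun k => ?_) (fun k => ?_)
    · refine hB.prod_apply_mem (fun i hi => lt_of_mem_normalWord hi) ?_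
      rw [← sub_add_cancel (((segmentWord m j).map B).prod _)
        ((u j : R3) • Finsupp.single (w' j) 1)]
      refine add_mem (letterSpan_mono (entrySet_mono (Nat.le_of_lt hj) w) (hmem j)) ?_
      exact Submodule.smul_mem _ _ (single_mem_letterSpan ⟨j, hj, hw' j⟩)
    · rw [← map_sub]
      exact hB.prod_apply_mem (fun i hi => lt_of_mem_normalWord hi) (hmem k)
    · refine hB.prod_apply_mem (fun i hi => lt_of_mem_normalWord hi) ?_
      exact Submodule.smul_mem _ _ (single_mem_letterSpan (hw' k))
    · refine Finsupp.disjoint_supported_supported (Set.disjoint_left.2 fun w'' h1 h2 => ?_)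
      rw [Set.mem_ofPred_eq, Set.mem_singleton_iff] at h1
      rw [Set.mem_ofPred_eq, h1] at h2
      exact entry_notMem_entrySet hw m k h2
    · simp only [map_smul]
      exact (ih (hg k)).units_smul fun _ => u k

end HB

open InvolutiveRelations

/-! ### The generators `b_i` and the monomial basis. -/

namespace HB

/-- The inverse of `q + 1`. -/
noncomputable def invQ : R3 := ((R3.isUnit_q_add_one.unit⁻¹ : R3ˣ) : R3)

/-- The inverse of `2`. -/
noncomputable def half : R3 := ((R3.isUnit_two.unit⁻¹ : R3ˣ) : R3)

theorem invQ_mul : invQ * (R3.q + 1) = 1 := R3.isUnit_q_add_one.val_inv_mul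

theorem half_add_half : half + half = 1 := by
  have h : half * (1 + 1) = 1 := R3.isUnit_two.val_inv_mul
  rwa [mul_add, mul_one] at h

theorem half_mul_two : half * 2 = 1 := by
  rw [mul_two, half_add_half]

/-- The affine change of variables that turns `a_i` into `b_i`. -/
noncomputable def normalize {A : Type} [Ring A] [Algebra R3 A] (x : A) : A :=
  invQ • (x - (algebraMap R3 A (R3.q - 1) - x))

theorem map_normalize {A A' : Type} [Ring A] [Algebra R3 A] [Ring A'] [Algebra R3 A']
    (f : A →ₐ[R3] A') (x : A) : f (normalize x) = normalize (f x) := by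
  simp only [normalize, map_smul, map_sub, AlgHom.commutes]

/-- This is the purpose of the normalization: the involution `x ↦ (q - 1) - x` becomes a change of
sign. -/
theorem normalize_sub {A : Type} [Ring A] [Algebra R3 A] (x : A) :
    normalize (algebraMap R3 A (R3.q - 1) - x) = -normalize x := by
  rw [normalize, normalize, ← smul_neg]
  congr 1
  abel

theorem normalize_sq {A : Type} [Ring A] [Algebra R3 A] {x : A}
    (hx : x * x = (R3.q - 1) • x + algebraMap R3 A R3.q) : normalize x * normalize x = 1 := by
  have h : normalize x * normalize x = (invQ * (R3.q + 1)) ^ 2 • (1 : A) := by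
    simp only [normalize, Algebra.algebraMap_eq_smul_one] at hx ⊢
    simp only [mul_sub, sub_mul, hx, smul_mul_assoc, mul_smul_comm, one_mul, mul_one]
    module
  rw [h, invQ_mul, one_pow, one_smul]

/-- The braid relation survives up to a linear error, with `κ = ((q - 1)/(q + 1))²`. The error is
odd in the normalized generators, as it must be for the sign changes to respect the relation. -/
theorem normalize_braid {A : Type} [Ring A] [Algebra R3 A] {x y : A}
    (hx : x * x = (R3.q - 1) • x + algebraMap R3 A R3.q)
    (hy : y * y = (R3.q - 1) • y + algebraMap R3 A R3.q) (h : x * y * x = y * x * y) :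
    normalize x * normalize y * normalize x = normalize y * normalize x * normalize y
      + (invQ * (R3.q - 1)) ^ 2 • (normalize y - normalize x) := by
  simp only [normalize, Algebra.algebraMap_eq_smul_one] at hx hy ⊢
  simp only [mul_sub, sub_mul, hx, hy, h, smul_mul_assoc, mul_smul_comm, one_mul, mul_one,
    smul_sub, smul_add]
  module

theorem normalize_braid_four {A : Type} [Ring A] [Algebra R3 A] {x y : A}
    (hx : x * x = 1) (h : x * y * x * y = y * x * y * x) :
    x * normalize y * x * normalize y = normalize y * x * normalize y * x := by
  have h' : y * x * x = y := by rw [mul_assoc, hx, mul_one]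
  simp only [normalize, Algebra.algebraMap_eq_smul_one]
  simp only [mul_sub, sub_mul, hx, h, h', smul_mul_assoc, mul_smul_comm, one_mul, mul_one,
    smul_sub]
  module

theorem commute_normalize {A : Type} [Ring A] [Algebra R3 A] {x y : A} (h : Commute x y) :
    Commute x (normalize y) := by
  have hc : Commute x (algebraMap R3 A (R3.q - 1)) := (Algebra.commutes _ x).symm
  exact (h.sub_right (hc.sub_right h)).smul_right _

/-- The inverse change of variables; here 2 must be invertible, so that the `b_i` generate the
algebra. -/
theorem eq_of_normalize {A : Type} [Ring A] [Algebra R3 A] (x : A) :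
    x = half • ((R3.q + 1) • normalize x + algebraMap R3 A (R3.q - 1)) := by
  have h : half • ((R3.q + 1) • normalize x + algebraMap R3 A (R3.q - 1))
      = (half * 2 * (invQ * (R3.q + 1))) • x +
        (half * (R3.q - 1) * (1 - invQ * (R3.q + 1))) • (1 : A) := by
    simp only [normalize, Algebra.algebraMap_eq_smul_one]
    module
  rw [h, invQ_mul, half_mul_two]
  module

variable {n : ℕ}

theorem natural_a (i : Fin n) : natural n (HeckeB.a i) = naturalGen i :=
  HeckeB.lift_a _ _ _

theorem flat_a (i : Fin n) : flat n (HeckeB.a i) = flatGen i :=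
  HeckeB.lift_a _ _ _

theorem sharp_a (i : Fin n) : sharp n (HeckeB.a i) = sharpGen i :=
  HeckeB.lift_a _ _ _

theorem b_of_eq_zero {i : Fin n} (hi : i.val = 0) : b i = HeckeB.a i := by
  rw [b, if_pos hi, natural_a, naturalGen, if_pos hi, sub_neg_eq_add, smul_add, ← add_smul]
  exact (congrArg (· • HeckeB.a i) half_add_half).trans (one_smul _ _)

theorem b_of_ne_zero {i : Fin n} (hi : i.val ≠ 0) : b i = normalize (HeckeB.a i) := by
  rw [b, if_neg hi, natural_a, naturalGen, if_neg hi]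
  rfl

/-- The generators `b_1, b_2, …`, indexed by natural numbers. -/
noncomputable def natB (n : ℕ) (i : ℕ) : HB n := if h : i < n then b ⟨i, h⟩ else 1

theorem natB_val (i : Fin n) : natB n i = b i := by
  rw [natB, dif_pos i.isLt]

theorem natB_eq {i : ℕ} (hi : i < n) : natB n i = b ⟨i, hi⟩ := dif_pos hi

theorem b_mul_b (i : Fin n) : b i * b i = 1 := by
  by_cases hi : i.val = 0
  · rw [b_of_eq_zero hi, a_mul_a_of_eq_zero i hi]
  · rw [b_of_ne_zero hi, normalize_sq (HeckeB.relations_a.quad i hi)]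

theorem b_comm {i j : Fin n} (hij : i.val + 1 < j.val) : Commute (b i) (b j) := by
  have h : Commute (HeckeB.a i : HB n) (HeckeB.a j) := HeckeB.relations_a.comm i j (Or.inl hij)
  have hj : j.val ≠ 0 := by omega
  rw [b_of_ne_zero hj]
  by_cases hi : i.val = 0
  · rw [b_of_eq_zero hi]
    exact commute_normalize h
  · rw [b_of_ne_zero hi]
    exact commute_normalize (commute_normalize h.symm).symm

theorem involutiveRelations_natB (n : ℕ) :
    InvolutiveRelations n ((invQ * (R3.q - 1)) ^ 2) (natB n) where
  sq i hi := by rw [natB_eq hi, b_mul_b]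
  four hn := by
    rw [natB_eq hn, natB_eq (Nat.zero_lt_of_lt hn), b_of_eq_zero rfl, b_of_ne_zero one_ne_zero]
    exact normalize_braid_four (a_mul_a_of_eq_zero _ rfl)
      (HeckeB.relations_a.braid_four _ _ rfl rfl)
  three i hi hi' := by
    have h := (HeckeB.relations_a (u := (1 : R3)) (q := R3.q) (n := n))
    rw [natB_eq hi', natB_eq (Nat.lt_of_succ_lt hi'), b_of_ne_zero hi.ne',
      b_of_ne_zero (Nat.succ_ne_zero i)]
    exact normalize_braid (h.quad _ hi.ne') (h.quad _ (Nat.succ_ne_zero i))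
      (h.braid_three _ _ hi.ne' rfl)
  comm i j hij hj := by
    rw [natB_eq hj, natB_eq (by omega)]
    exact b_comm hij

theorem adjoin_range_a : Algebra.adjoin R3 (Set.range (HeckeB.a : Fin n → HB n)) = ⊤ := by
  have h : Set.range (HeckeB.a : Fin n → HB n) =
      RingQuot.mkAlgHom R3 (HeckeBRel R3 n 1 R3.q) '' Set.range (FreeAlgebra.ι R3) := by
    rw [← Set.range_comp]
    rfl
  have h' := AlgHom.map_adjoin (RingQuot.mkAlgHom R3 (HeckeBRel R3 n 1 R3.q))
    (Set.range (FreeAlgebra.ι R3))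
  rw [FreeAlgebra.adjoin_range_ι, Algebra.map_top,
    (AlgHom.range_eq_top _).2 (RingQuot.mkAlgHom_surjective R3 _)] at h'
  rw [h]
  exact h'.symm

theorem adjoin_range_b : Algebra.adjoin R3 (Set.range (b : Fin n → HB n)) = ⊤ := by
  rw [← top_le_iff, ← adjoin_range_a]
  refine Algebra.adjoin_le ?_
  rintro _ ⟨i, rfl⟩
  have hb : b i ∈ Algebra.adjoin R3 (Set.range (b : Fin n → HB n)) :=
    Algebra.subset_adjoin ⟨i, rfl⟩
  by_cases hi : i.val = 0
  · rwa [b_of_eq_zero hi] at hb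
  · rw [b_of_ne_zero hi] at hb
    rw [SetLike.mem_coe, eq_of_normalize (HeckeB.a i)]
    exact Subalgebra.smul_mem _ (add_mem (Subalgebra.smul_mem _ hb _)
      (Subalgebra.algebraMap_mem _ _)) _

theorem algHom_ext_b {A : Type} [Ring A] [Algebra R3 A] {f g : HB n →ₐ[R3] A}
    (h : ∀ i, f (b i) = g (b i)) : f = g := by
  refine AlgHom.ext_of_adjoin_eq_top adjoin_range_b ?_
  rintro _ ⟨i, rfl⟩
  exact h i

theorem map_val_word (M : NormalForm n) : M.word.map Fin.val = normalWord M := by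
  rw [NormalForm.word, List.map_flatMap, normalWord]
  refine List.flatMap_congr fun i _ => ?_
  rw [segment, segmentWord, List.map_ofFn, List.ofFn_eq_map, ← List.map_coe_finRange_eq_range,
    List.map_map]
  rfl

theorem monomial_eq (M : NormalForm n) : M.monomial = ((normalWord M).map (natB n)).prod := by
  rw [NormalForm.monomial, ← map_val_word, List.map_map]
  congr 2
  funext i
  exact (natB_val i).symm

theorem span_monomial : Submodule.span R3 (Set.range (NormalForm.monomial (n := n))) = ⊤ := by
  have h := initial_le_span_normalWord (involutiveRelations_natB n) le_rfl
  have htop : initial R3 (natB n) n = ⊤ := by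
    rw [← top_le_iff, ← adjoin_range_b]
    refine Algebra.adjoin_le ?_
    rintro _ ⟨i, rfl⟩
    rw [← natB_val]
    exact gen_mem_initial i.isLt
  rw [htop, Algebra.top_toSubmodule, top_le_iff] at h
  rw [← h]
  congr 2
  funext M
  exact monomial_eq M

theorem wordAction_relations :
    HeckeB.Relations 1 R3.q fun i : Fin n => wordAction i.val where
  quad_first i hi := by simp [hi, wordAction_zero_sq]
  quad i hi := by
    obtain ⟨k, hk⟩ := Nat.exists_eq_succ_of_ne_zero hi
    rw [hk]
    exact wordAction_succ_sq k
  braid_four i j hi hj := by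
    rw [hi, hj]
    exact wordAction_braid_four
  braid_three i j hi hj := by
    obtain ⟨k, hk⟩ := Nat.exists_eq_succ_of_ne_zero hi
    rw [hj, hk]
    exact wordAction_braid_three k
  comm i j hij := by
    rcases hij with h | h
    · exact wordAction_comm _ _ h
    · exact (wordAction_comm _ _ h).symm

/-- The representation of the Hecke algebra on the free module on words. -/
noncomputable def wordRep (n : ℕ) : HB n →ₐ[R3] Module.End R3 (IntWord →₀ R3) :=
  HeckeB.lift (fun i : Fin n => wordAction i.val) wordAction_relations

/-- The action of `b_{i+1}` on words. -/
noncomputable def normalAction (i : ℕ) : Module.End R3 (IntWord →₀ R3) :=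
  if i = 0 then wordAction 0 else normalize (wordAction i)

theorem wordRep_natB {i : ℕ} (hi : i < n) : wordRep n (natB n i) = normalAction i := by
  have h : wordRep n (HeckeB.a ⟨i, hi⟩) = wordAction i := HeckeB.lift_a _ _ _
  rw [natB_eq hi, normalAction]
  split_ifs with h0
  · rw [b_of_eq_zero (i := ⟨i, hi⟩) h0, h, h0]
  · rw [b_of_ne_zero (i := ⟨i, hi⟩) h0, ← h]
    simp only [normalize, map_smul, map_sub, AlgHom.commutes]

theorem isReflecting_normalAction : IsReflecting normalAction where
  exists_eq i w := by
    rcases Nat.eq_zero_or_pos i with rfl | hi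
    · refine ⟨0, 1, fun _ => isUnit_one, ?_⟩
      simp [normalAction, wordAction_single, diagCoeff, offCoeff]
    -- Read off from `b_i = (2 a_i - (q - 1)) / (q + 1)`. On generic words the off-diagonal
    -- coefficient of `a_i` is `1` or `q`, so multiplying by `2 / (q + 1)` keeps it a unit.
    · refine ⟨invQ * (2 * diagCoeff i w - (R3.q - 1)), invQ * (2 * offCoeff i w), fun hw => ?_, ?_⟩
      · have h2 : IsUnit (2 : R3) := IsUnit.of_mul_eq_one half (by rw [mul_comm, half_mul_two])
        have hc : IsUnit invQ := IsUnit.of_mul_eq_one _ invQ_mul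
        refine hc.mul (h2.mul ?_)
        rw [offCoeff, if_neg hi.ne']
        have hne : w (i - 1) ≠ w i := fun h => by
          have := hw.1 h
          omega
        split_ifs with h h'
        · exact isUnit_one
        · exact isUnit_of_mul_isUnit_right (isUnit_of_mul_isUnit_left R3.isUnit_prod)
        · exact absurd (le_antisymm (not_lt.1 h') (not_lt.1 h)) hne
      · rw [normalAction, if_neg hi.ne', normalize]
        simp only [LinearMap.smul_apply, LinearMap.sub_apply, Module.algebraMap_end_apply,
          wordAction_single]
        module

/-- Independence is tested on the orbit of the single word `1, 2, 3, …`; starting at 1 avoids the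
letter 0, which equals its own negative. -/
theorem linearIndependent_monomial :
    LinearIndependent R3 (NormalForm.monomial (n := n)) := by
  have hw : IsGeneric fun i => (i : ℤ) + 1 :=
    ⟨fun i j h => by simpa using h, fun i j h => by simp only at h; omega⟩
  refine LinearIndependent.of_comp
    (LinearMap.applyₗ (Finsupp.single (fun i : ℕ => (i : ℤ) + 1) (1 : R3)) ∘ₗ
      (wordRep n).toLinearMap) ?_
  have h := isReflecting_normalAction.linearIndependent n hw
  have e : (LinearMap.applyₗ (Finsupp.single (fun i : ℕ => (i : ℤ) + 1) (1 : R3)) ∘ₗ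
      (wordRep n).toLinearMap) ∘ NormalForm.monomial = fun M : NormalForm n =>
        ((normalWord M).map normalAction).prod (Finsupp.single (fun i : ℕ => (i : ℤ) + 1) 1) := by
    funext M
    simp only [Function.comp_apply, LinearMap.comp_apply, LinearMap.applyₗ_apply_apply,
      AlgHom.toLinearMap_apply, monomial_eq, map_list_prod, List.map_map]
    congr 2
    exact List.map_congr_left fun i hi => wordRep_natB (lt_of_mem_normalWord hi)
  rw [e]
  exact h

end HB

/-! ### Crossed products from involutions. -/

/-- A subalgebra with an involution is a crossed product of its eigenspaces if `2` is invertible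
and there is a unit in the eigenspace for `-1`. -/
theorem isZ2CrossedProduct_of_involution {R A : Type} [CommRing R] [Ring A] [Algebra R A]
    {B : Subalgebra R A} [Module.Finite R B] (θ : A →ₐ[R] A) (hθB : ∀ x ∈ B, θ x ∈ B)
    (hθθ : ∀ x ∈ B, θ (θ x) = x) {h : R} (hh : h + h = 1) {P Q : Submodule R A}
    (hP : ∀ x, x ∈ P ↔ x ∈ B ∧ θ x = x) (hQ : ∀ x, x ∈ Q ↔ x ∈ B ∧ θ x = -x)
    {g g' : A} (hg : g ∈ Q) (hg' : g' ∈ B) (hgg' : g * g' = 1) (hg'g : g' * g = 1) :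
    IsZ2CrossedProduct B P Q := by
  obtain ⟨hgB, hgθ⟩ := (hQ g).1 hg
  have hθg' : θ g' = -g' := by
    have h1 : θ g' * θ g = 1 := by rw [← map_mul, hg'g, map_one]
    have h2 : θ g' * θ g * g' = g' := by rw [h1, one_mul]
    rw [hgθ, mul_neg, neg_mul, mul_assoc, hgg', mul_one] at h2
    rw [← h2, neg_neg, h2]
  let sgn : Multiplicative (ZMod 2) → R := fun s => if s = 1 then 1 else -1
  have hcases : ∀ s : Multiplicative (ZMod 2), s = 1 ∨ s = Multiplicative.ofAdd 1 := by decide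
  have hne : (Multiplicative.ofAdd 1 : Multiplicative (ZMod 2)) ≠ 1 := by decide
  have hss : ∀ s : Multiplicative (ZMod 2), s * s = 1 := by decide
  have hsgn1 : sgn 1 = 1 := if_pos rfl
  have hsgn2 : sgn (Multiplicative.ofAdd 1) = -1 := if_neg hne
  have hsgn : ∀ s t, sgn (s * t) = sgn s * sgn t := by
    intro s t
    rcases hcases s with rfl | rfl <;> rcases hcases t with rfl | rfl <;>
      simp [hsgn1, hsgn2, hss]
  let 𝒜 : Multiplicative (ZMod 2) → Submodule R B := fun s =>
    if s = 1 then P.comap B.val.toLinearMap else Q.comap B.val.toLinearMap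
  have h𝒜1 : 𝒜 1 = P.comap B.val.toLinearMap := if_pos rfl
  have h𝒜2 : 𝒜 (Multiplicative.ofAdd 1) = Q.comap B.val.toLinearMap := if_neg hne
  -- Both components become eigenspaces of `θ` for the character `sgn`, so compatibility with
  -- products follows from multiplicativity of `sgn`.
  have hmem : ∀ s (x : B), x ∈ 𝒜 s ↔ θ (x : A) = sgn s • (x : A) := by
    intro s x
    rcases hcases s with rfl | rfl
    · rw [h𝒜1, hsgn1, one_smul]
      exact (hP x).trans (and_iff_right x.2)
    · rw [h𝒜2, hsgn2, neg_one_smul]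
      exact (hQ x).trans (and_iff_right x.2)
  have hmul : ∀ {s t} {x y : B}, x ∈ 𝒜 s → y ∈ 𝒜 t → x * y ∈ 𝒜 (s * t) := by
    intro s t x y hx hy
    rw [hmem] at hx hy ⊢
    rw [MulMemClass.coe_mul, map_mul, hx, hy, hsgn, smul_mul_smul_comm]
  have hunit : ∀ s, ∃ u : Bˣ, (u : B) ∈ 𝒜 s ∧ ((u⁻¹ : Bˣ) : B) ∈ 𝒜 s := by
    intro s
    rcases hcases s with rfl | rfl
    · refine ⟨1, ?_, ?_⟩ <;> simp [hmem, hsgn1]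
    · refine ⟨⟨⟨g, hgB⟩, ⟨g', hg'⟩, Subtype.ext hgg', Subtype.ext hg'g⟩, ?_, ?_⟩
      · rw [hmem, hsgn2, neg_one_smul]
        exact hgθ
      · rw [hmem, hsgn2, neg_one_smul]
        exact hθg'
  refine ⟨𝒜, ⟨inferInstance, fun s t => le_antisymm ?_ ?_, fun s => ?_, ?_, ?_⟩, ?_, ?_⟩
  · exact Submodule.mul_le.2 fun x hx y hy => hmul hx hy
  -- Write `z = (z u⁻¹) u` with `u` a homogeneous unit of degree `t`; its inverse also has degree
  -- `t`, because `t² = 1`.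
  · intro z hz
    obtain ⟨u, hu, hu'⟩ := hunit t
    have h1 := hmul hz hu'
    rw [mul_assoc, hss, mul_one] at h1
    have h2 := Submodule.mul_mem_mul h1 hu
    rwa [mul_assoc, Units.inv_mul, mul_one] at h2
  · obtain ⟨u, hu, hu'⟩ := hunit s
    refine ⟨u, le_antisymm ?_ ?_, le_antisymm ?_ ?_⟩
    · intro z hz
      refine ⟨(u⁻¹ : Bˣ) * z, ?_, by simp⟩
      have h1 := hmul hu' hz
      rwa [hss] at h1
    · rintro _ ⟨z, hz, rfl⟩
      have h1 := hmul hu hz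
      rwa [mul_one] at h1
    · intro z hz
      refine ⟨z * (u⁻¹ : Bˣ), ?_, by simp⟩
      have h1 := hmul hz hu'
      rwa [hss] at h1
    · rintro _ ⟨z, hz, rfl⟩
      have h1 := hmul hz hu
      rwa [one_mul] at h1
  · rw [DirectSum.isInternal_submodule_iff_isCompl 𝒜 hne.symm
      (Set.eq_univ_of_forall hcases).symm]
    refine IsCompl.of_eq ?_ ?_
    · rw [Submodule.eq_bot_iff]
      rintro x ⟨h1, h2⟩
      rw [SetLike.mem_coe, hmem] at h1 h2
      rw [h1, hsgn1, hsgn2, one_smul, neg_one_smul] at h2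
      have h3 : (x : A) = h • ((x : A) + x) := by rw [smul_add, ← add_smul, hh, one_smul]
      rw [← Subtype.coe_inj, h3]
      nth_rewrite 1 [h2]
      simp
    · rw [eq_top_iff]
      intro x _
      -- The averages of `x` with `θ x` and with `-θ x` are its two homogeneous components.
      have hx : x = h • (x + ⟨θ x, hθB x x.2⟩) + h • (x - ⟨θ x, hθB x x.2⟩) := by
        rw [← smul_add, add_add_sub_cancel, smul_add, ← add_smul, hh, one_smul]
      rw [hx]
      refine Submodule.add_mem_sup (Submodule.smul_mem _ _ ?_) (Submodule.smul_mem _ _ ?_)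
      · rw [hmem, hsgn1, one_smul]
        simp only [AddMemClass.coe_add, map_add, hθθ x x.2]
        exact add_comm _ _
      · rw [hmem, hsgn2, neg_one_smul]
        simp only [AddSubgroupClass.coe_sub, map_sub, hθθ x x.2]
        exact (neg_sub _ _).symm
  · simp [hmem, hsgn1]
  · refine (congrArg _ h𝒜1).trans (Submodule.map_comap_eq_of_le fun x hx => ?_)
    exact ⟨⟨x, ((hP x).1 hx).1⟩, rfl⟩
  · refine (congrArg _ h𝒜2).trans (Submodule.map_comap_eq_of_le fun x hx => ?_)
    exact ⟨⟨x, ((hQ x).1 hx).1⟩, rfl⟩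

/-! ### Sign eigenspaces and the subalgebra `†`. -/

namespace HB

variable {n : ℕ}

theorem sharp_b (i : Fin n) : sharp n (b i) = if i.val = 0 then -b i else b i := by
  split_ifs with hi
  · rw [b_of_eq_zero hi, sharp_a, sharpGen, if_pos hi]
  · rw [b_of_ne_zero hi, map_normalize, sharp_a, sharpGen, if_neg hi]

theorem flat_b (i : Fin n) : flat n (b i) = if i.val = 0 then b i else -b i := by
  split_ifs with hi
  · rw [b_of_eq_zero hi, flat_a, flatGen, if_pos hi]
  · rw [b_of_ne_zero hi, map_normalize, flat_a, flatGen, if_neg hi, normalize_sub]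

theorem natural_b (i : Fin n) : natural n (b i) = -b i := by
  by_cases hi : i.val = 0
  · rw [b_of_eq_zero hi, natural_a, naturalGen, if_pos hi]
  · rw [b_of_ne_zero hi, map_normalize, natural_a, naturalGen, if_neg hi, normalize_sub]

theorem sharp_sharp (x : HB n) : sharp n (sharp n x) = x := by
  refine DFunLike.congr_fun (f := (sharp n).comp (sharp n)) (g := AlgHom.id R3 _)
    (algHom_ext_b fun i => ?_) x
  simp only [AlgHom.comp_apply, AlgHom.id_apply, sharp_b]
  split_ifs with hi <;> simp [sharp_b, hi]

theorem flat_flat (x : HB n) : flat n (flat n x) = x := by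
  refine DFunLike.congr_fun (f := (flat n).comp (flat n)) (g := AlgHom.id R3 _)
    (algHom_ext_b fun i => ?_) x
  simp only [AlgHom.comp_apply, AlgHom.id_apply, flat_b]
  split_ifs with hi <;> simp [flat_b, hi]

theorem flat_sharp (x : HB n) : flat n (sharp n x) = natural n x := by
  refine DFunLike.congr_fun (f := (flat n).comp (sharp n)) (g := natural n)
    (algHom_ext_b fun i => ?_) x
  simp only [AlgHom.comp_apply, natural_b, sharp_b]
  split_ifs with hi <;> simp [flat_b, hi]

theorem sharp_flat (x : HB n) : sharp n (flat n x) = natural n x := by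
  refine DFunLike.congr_fun (f := (sharp n).comp (flat n)) (g := natural n)
    (algHom_ext_b fun i => ?_) x
  simp only [AlgHom.comp_apply, natural_b, flat_b]
  split_ifs with hi <;> simp [sharp_b, hi]

theorem sharp_prod (l : List (Fin n)) :
    sharp n (l.map b).prod = (-1 : R3) ^ l.countP (fun i => i.val = 0) • (l.map b).prod := by
  induction l with
  | nil => simp
  | cons i l ih =>
    rw [List.map_cons, List.prod_cons, map_mul, ih, sharp_b, List.countP_cons]
    by_cases hi : i.val = 0 <;> simp [hi, pow_succ]

theorem flat_prod (l : List (Fin n)) :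
    flat n (l.map b).prod = (-1 : R3) ^ l.countP (fun i => i.val ≠ 0) • (l.map b).prod := by
  induction l with
  | nil => simp
  | cons i l ih =>
    rw [List.map_cons, List.prod_cons, map_mul, ih, flat_b, List.countP_cons]
    by_cases hi : i.val = 0 <;> simp [hi, pow_succ]

theorem sharp_monomial (M : NormalForm n) :
    sharp n M.monomial = (-1 : R3) ^ M.countFirst • M.monomial :=
  sharp_prod M.word

theorem flat_monomial (M : NormalForm n) :
    flat n M.monomial = (-1 : R3) ^ M.countOther • M.monomial :=
  flat_prod M.word

/-- The simultaneous eigenspace of `♯` and `♭` for the eigenvalues `(-1)^p` and `(-1)^r`. -/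
noncomputable def eigen (n p r : ℕ) : Submodule R3 (HB n) :=
  LinearMap.eqLocus (sharp n).toLinearMap ((-1 : R3) ^ p • LinearMap.id) ⊓
    LinearMap.eqLocus (flat n).toLinearMap ((-1 : R3) ^ r • LinearMap.id)

theorem mem_eigen {p r : ℕ} {x : HB n} :
    x ∈ eigen n p r ↔ sharp n x = (-1 : R3) ^ p • x ∧ flat n x = (-1 : R3) ^ r • x :=
  Iff.rfl

/-- The monomials whose numbers of letters have given parities. -/
def parityClass (n p r : ℕ) : Set (NormalForm n) :=
  {M | Even (M.countFirst + p) ∧ Even (M.countOther + r)}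

/-- The projection onto the eigenspace of `f` for `(-1)^p`. -/
noncomputable def signProj (f : HB n →ₐ[R3] HB n) (p : ℕ) : HB n →ₗ[R3] HB n :=
  half • (LinearMap.id + (-1 : R3) ^ p • f.toLinearMap)

theorem signProj_apply {f : HB n →ₐ[R3] HB n} {p k : ℕ} {x : HB n}
    (hx : f x = (-1 : R3) ^ k • x) : signProj f p x = if Even (k + p) then x else 0 := by
  have h : signProj f p x = (half * (1 + (-1) ^ (k + p))) • x := by
    simp only [signProj, LinearMap.smul_apply, LinearMap.add_apply, LinearMap.id_apply,
      AlgHom.toLinearMap_apply, hx, pow_add]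
    module
  rw [h]
  split_ifs with hp
  · rw [hp.neg_one_pow, mul_add, mul_one, half_add_half, one_smul]
  · rw [(Nat.not_even_iff_odd.1 hp).neg_one_pow, add_neg_cancel, mul_zero, zero_smul]

/-- The monomial basis consists of common eigenvectors. The composite of the two sign projections
fixes the eigenspace, keeps the monomials of the right parities and kills the others, so those kept
span. -/
theorem isFreeOn_eigen (n p r : ℕ) : IsFreeOn (eigen n p r) (parityClass n p r) := by
  refine ⟨linearIndependent_monomial.comp _ Subtype.val_injective, le_antisymm ?_ ?_⟩
  · refine Submodule.span_le.2 ?_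
    rintro _ ⟨⟨M, h1, h2⟩, rfl⟩
    have key : ∀ {k p : ℕ}, Even (k + p) → (-1 : R3) ^ k = (-1) ^ p := by
      intro k p h
      rcases Nat.even_or_odd k with hk | hk
      · rw [hk.neg_one_pow, ((Nat.even_add.1 h).1 hk).neg_one_pow]
      · have hp : Odd p := by grind
        rw [hk.neg_one_pow, hp.neg_one_pow]
    refine mem_eigen.2 ⟨?_, ?_⟩
    · rw [← key h1]
      exact sharp_monomial M
    · rw [← key h2]
      exact flat_monomial M
  · intro x hx
    obtain ⟨h1, h2⟩ := mem_eigen.1 hx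
    have e : signProj (sharp n) p (signProj (flat n) r x) = x := by
      rw [signProj_apply h2, if_pos ⟨r, rfl⟩, signProj_apply h1, if_pos ⟨p, rfl⟩]
    have hle : (⊤ : Submodule R3 (HB n)) ≤ Submodule.comap
        (signProj (sharp n) p ∘ₗ signProj (flat n) r)
        (Submodule.span R3 (Set.range fun M : parityClass n p r => M.val.monomial)) := by
      rw [← span_monomial]
      refine Submodule.span_le.2 ?_
      rintro _ ⟨M, rfl⟩
      rw [SetLike.mem_coe, Submodule.mem_comap, LinearMap.comp_apply,
        signProj_apply (flat_monomial M)]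
      split_ifs with hr
      · rw [signProj_apply (sharp_monomial M)]
        split_ifs with hp
        · exact Submodule.subset_span ⟨⟨M, hp, hr⟩, rfl⟩
        · exact zero_mem _
      · rw [map_zero]
        exact zero_mem _
    have hx' := hle (Submodule.mem_top (x := x))
    rwa [Submodule.mem_comap, LinearMap.comp_apply, e] at hx'

theorem parityClass_even_even : parityClass n 0 0 = classX n := rfl

theorem parityClass_odd_even : parityClass n 1 0 = classY n := by
  ext M
  simp [parityClass, classY, Nat.even_add_one]

theorem parityClass_even_odd : parityClass n 0 1 = classZ n := by
  ext M
  simp [parityClass, classZ, Nat.even_add_one]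

theorem parityClass_odd_odd : parityClass n 1 1 = classW n := by
  ext M
  simp [parityClass, classW, Nat.even_add_one]

theorem mem_fixedSharp {x : HB n} : x ∈ fixedSharp n ↔ sharp n x = x := Iff.rfl

theorem mem_fixedFlat {x : HB n} : x ∈ fixedFlat n ↔ flat n x = x := Iff.rfl

theorem mem_fixedNatural {x : HB n} : x ∈ fixedNatural n ↔ natural n x = x := Iff.rfl

/-- Since `♮ = ♭♯`, an element fixed by `♯` is fixed by `♮` exactly when it is fixed by `♭`. -/
theorem fixedSharp_inf_fixedNatural : fixedSharp n ⊓ fixedNatural n = fixedFlat n ⊓ fixedSharp n := by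
  ext x
  rw [Algebra.mem_inf, Algebra.mem_inf, mem_fixedSharp, mem_fixedNatural, mem_fixedFlat,
    and_comm (a := flat n x = x), ← flat_sharp]
  exact and_congr_right fun h => by rw [h]

theorem fixedNatural_inf_fixedFlat : fixedNatural n ⊓ fixedFlat n = fixedFlat n ⊓ fixedSharp n := by
  ext x
  rw [Algebra.mem_inf, Algebra.mem_inf, mem_fixedSharp, mem_fixedNatural, mem_fixedFlat,
    and_comm, ← sharp_flat]
  exact and_congr_right fun h => by rw [h]

theorem mem_eigen_zero_zero {x : HB n} : x ∈ eigen n 0 0 ↔ x ∈ fixedFlat n ⊓ fixedSharp n := by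
  rw [mem_eigen, Algebra.mem_inf, mem_fixedFlat, mem_fixedSharp, pow_zero, one_smul, and_comm]

theorem sharp_bbar (hn : 2 ≤ n) (i : Fin n) : sharp n (bbar hn i) = bbar hn i := by
  unfold bbar
  split_ifs with hi <;> simp [sharp_b, hi]

theorem flat_bbar (hn : 2 ≤ n) (i : Fin n) : flat n (bbar hn i) = -bbar hn i := by
  unfold bbar
  split_ifs with hi <;> simp [flat_b, hi]

/-- Conjugation by `b_1` turns `b_2` into `b̄_1` and fixes `b_i` for `i ≥ 3`, which commutes with
`b_1`. -/
theorem b_zero_mul_b_mul_b_zero (hn : 2 ≤ n) {j : Fin n} (hj : j.val ≠ 0) :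
    ∃ k, b ⟨0, by omega⟩ * b j * b ⟨0, by omega⟩ = bbar hn k := by
  by_cases h1 : j = ⟨1, hn⟩
  · refine ⟨⟨0, by omega⟩, ?_⟩
    rw [bbar, if_pos rfl, h1]
  · refine ⟨j, ?_⟩
    have hc : Commute (b ⟨0, by omega⟩) (b j) := b_comm (by
      have : j.val ≠ 1 := fun h => h1 (Fin.ext h)
      simp only
      omega)
    rw [bbar, if_neg hj, hc.eq, mul_assoc, b_mul_b, mul_one]

/-- All factors `b_1` are moved to the right end. Each other letter, on passing them, becomes
exactly one `b̄_k`, so the length of `w` counts those letters. -/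
theorem prod_b_eq (hn : 2 ≤ n) (l : List (Fin n)) :
    ∃ w : List (Fin n), w.length = l.countP (fun i => i.val ≠ 0) ∧
      (l.map b).prod = (w.map (bbar hn)).prod *
        b ⟨0, by omega⟩ ^ l.countP (fun i => i.val = 0) := by
  induction l using List.reverseRecOn with
  | nil => exact ⟨[], by simp⟩
  | append_singleton l j ih =>
    obtain ⟨w, hw, h⟩ := ih
    by_cases hj : j.val = 0
    · refine ⟨w, by simp [hw, hj], ?_⟩
      have hj' : j = ⟨0, by omega⟩ := Fin.ext hj
      rw [List.map_append, List.prod_append, h, List.countP_append, pow_add, ← mul_assoc, hj']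
      simp
    · have hsq : b ⟨0, by omega⟩ ^ 2 = (1 : HB n) := by rw [pow_two, b_mul_b]
      obtain ⟨k, hk⟩ : ∃ k, b ⟨0, by omega⟩ ^ l.countP (fun i => i.val = 0) * b j
          = bbar hn k * b ⟨0, by omega⟩ ^ l.countP (fun i => i.val = 0) := by
        rcases Nat.even_or_odd' (l.countP fun i => i.val = 0) with ⟨p, hp | hp⟩
        · refine ⟨j, ?_⟩
          rw [hp, pow_mul, hsq, one_pow, one_mul, mul_one, bbar, if_neg hj]
        · obtain ⟨k, hk⟩ := b_zero_mul_b_mul_b_zero hn hj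
          refine ⟨k, ?_⟩
          rw [hp, pow_succ, pow_mul, hsq, one_pow, one_mul, ← hk, mul_assoc _ _ (b ⟨0, _⟩), b_mul_b,
            mul_one]
      refine ⟨w ++ [k], by simp [hw, hj], ?_⟩
      rw [List.map_append, List.prod_append, h, List.countP_append, mul_assoc]
      simp only [List.map_singleton, List.prod_singleton, hk]
      simp [hj, mul_assoc]

/-- Each `b̄_i` is fixed by `♯` and negated by `♭`, so even products are fixed by both. Conversely
the fixed space is spanned by monomials with both counts even: in `prod_b_eq` the power of `b_1`
disappears and an even product of the `b̄_i` remains. -/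
theorem dagger_eq (hn : 2 ≤ n) : dagger hn = fixedFlat n ⊓ fixedSharp n := by
  refine le_antisymm (Algebra.adjoin_le ?_) fun x hx => ?_
  · rintro _ ⟨w, hw, rfl⟩
    have hs : sharp n (w.map (bbar hn)).prod = (w.map (bbar hn)).prod := by
      rw [map_list_prod, List.map_map]
      congr 2
      funext i
      exact sharp_bbar hn i
    have hf : ∀ l : List (Fin n), flat n (l.map (bbar hn)).prod
        = (-1 : R3) ^ l.length • (l.map (bbar hn)).prod := by
      intro l
      induction l with
      | nil => simp
      | cons i l ih =>
        rw [List.map_cons, List.prod_cons, map_mul, ih, flat_bbar]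
        simp [pow_succ]
    refine Algebra.mem_inf.2 ⟨?_, hs⟩
    rw [mem_fixedFlat, hf, hw.neg_one_pow, one_smul]
  · rw [← mem_eigen_zero_zero, ← (isFreeOn_eigen n 0 0).2] at hx
    refine (Submodule.span_le (p := Subalgebra.toSubmodule (dagger hn))).2 ?_ hx
    rintro _ ⟨⟨M, h1, h2⟩, rfl⟩
    obtain ⟨w, hw, h⟩ := prod_b_eq hn M.word
    rw [add_zero] at h1 h2
    obtain ⟨p, hp⟩ := even_iff_exists_two_mul.1 h1
    rw [NormalForm.countFirst] at hp
    rw [hp, pow_mul, pow_two, b_mul_b, one_pow, mul_one] at h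
    refine Algebra.subset_adjoin ⟨w, ?_, h⟩
    rw [hw]
    exact h2

theorem toSubmodule_dagger (hn : 2 ≤ n) : Subalgebra.toSubmodule (dagger hn) = eigen n 0 0 := by
  ext x
  rw [mem_eigen_zero_zero, ← dagger_eq hn]
  rfl

/-- Needed because a crossed product must be a finite module: the fixed subalgebras are submodules
of a finite module over a noetherian ring. -/
instance : IsNoetherianRing R3 :=
  IsLocalization.isNoetherianRing (Submonoid.powers (2 * X * (X + 1) : ℤ[X])) R3 inferInstance

instance : Module.Finite R3 (HB n) :=
  ⟨⟨(Set.finite_range NormalForm.monomial).toFinset, by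
    rw [Set.Finite.coe_toFinset, span_monomial]⟩⟩

instance (B : Subalgebra R3 (HB n)) : Module.Finite R3 B :=
  inferInstanceAs (Module.Finite R3 (Subalgebra.toSubmodule B))

end HB

/-! ### Assembly of the theorem. -/

theorem theorem5p4 (n : ℕ) (hn : 2 ≤ n) :
    (HB.dagger hn = HB.fixedSharp n ⊓ HB.fixedNatural n ∧
      HB.dagger hn = HB.fixedFlat n ⊓ HB.fixedSharp n ∧
      HB.dagger hn = HB.fixedNatural n ⊓ HB.fixedFlat n ∧
      HB.IsFreeOn (Subalgebra.toSubmodule (HB.dagger hn)) (HB.classX n)) ∧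
    (∃ oddSharp : Submodule R3 (HB n),
      IsZ2CrossedProduct (HB.fixedSharp n) (Subalgebra.toSubmodule (HB.dagger hn)) oddSharp ∧
      HB.IsFreeOn oddSharp (HB.classZ n)) ∧
    (∃ oddFlat : Submodule R3 (HB n),
      IsZ2CrossedProduct (HB.fixedFlat n) (Subalgebra.toSubmodule (HB.dagger hn)) oddFlat ∧
      HB.IsFreeOn oddFlat (HB.classY n)) ∧
    (∃ oddNatural : Submodule R3 (HB n),
      IsZ2CrossedProduct (HB.fixedNatural n) (Subalgebra.toSubmodule (HB.dagger hn)) oddNatural ∧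
      HB.IsFreeOn oddNatural (HB.classW n)) := by
  have hB0 := HB.sharp_b (n := n) ⟨0, by omega⟩
  have hF0 := HB.flat_b (n := n) ⟨0, by omega⟩
  have hB1 := HB.sharp_b (n := n) ⟨1, hn⟩
  have hF1 := HB.flat_b (n := n) ⟨1, hn⟩
  rw [if_pos rfl] at hB0 hF0
  rw [if_neg one_ne_zero] at hB1 hF1
  rw [HB.toSubmodule_dagger, HB.fixedSharp_inf_fixedNatural, HB.fixedNatural_inf_fixedFlat,
    ← HB.parityClass_even_even, ← HB.parityClass_odd_even, ← HB.parityClass_even_odd,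
    ← HB.parityClass_odd_odd]
  refine ⟨⟨HB.dagger_eq hn, HB.dagger_eq hn, HB.dagger_eq hn, HB.isFreeOn_eigen n 0 0⟩,
    ⟨_, ?_, HB.isFreeOn_eigen n 0 1⟩, ⟨_, ?_, HB.isFreeOn_eigen n 1 0⟩,
    ⟨_, ?_, HB.isFreeOn_eigen n 1 1⟩⟩
  -- On the `♯`-fixed elements the grading comes from `♭`; the odd unit is `b_2`, its own inverse.
  · refine isZ2CrossedProduct_of_involution (HB.flat n) (fun x hx => ?_)
      (fun x _ => HB.flat_flat x) HB.half_add_half (fun x => ?_) (fun x => ?_)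
      (g := HB.b ⟨1, hn⟩) (g' := HB.b ⟨1, hn⟩) ?_ hB1 (HB.b_mul_b _) (HB.b_mul_b _)
    · rw [HB.mem_fixedSharp] at hx ⊢
      rw [HB.sharp_flat, ← HB.flat_sharp, hx]
    · rw [HB.mem_eigen, HB.mem_fixedSharp, pow_zero, one_smul]
    · rw [HB.mem_eigen, HB.mem_fixedSharp, pow_zero, pow_one, one_smul, neg_one_smul]
    · rw [HB.mem_eigen, pow_zero, pow_one, one_smul, neg_one_smul]
      exact ⟨hB1, hF1⟩
  -- On the `♭`-fixed elements the grading comes from `♯`, with odd unit `b_1`.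
  · refine isZ2CrossedProduct_of_involution (HB.sharp n) (fun x hx => ?_)
      (fun x _ => HB.sharp_sharp x) HB.half_add_half (fun x => ?_) (fun x => ?_)
      (g := HB.b ⟨0, by omega⟩) (g' := HB.b ⟨0, by omega⟩) ?_ hF0 (HB.b_mul_b _) (HB.b_mul_b _)
    · rw [HB.mem_fixedFlat] at hx ⊢
      rw [HB.flat_sharp, ← HB.sharp_flat, hx]
    · rw [HB.mem_eigen, HB.mem_fixedFlat, pow_zero, one_smul, and_comm]
    · rw [HB.mem_eigen, HB.mem_fixedFlat, pow_zero, pow_one, one_smul, neg_one_smul, and_comm]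
    · rw [HB.mem_eigen, pow_zero, pow_one, one_smul, neg_one_smul]
      exact ⟨hB0, hF0⟩
  -- On the `♮`-fixed elements `♯` and `♭` agree, so either one gives the grading. The unit must be
  -- negated by both, which `b_1 b_2` is; its inverse is `b_2 b_1`.
  · refine isZ2CrossedProduct_of_involution (HB.sharp n) (fun x hx => ?_)
      (fun x _ => HB.sharp_sharp x) HB.half_add_half (fun x => ?_) (fun x => ?_)
      (g := HB.b ⟨0, by omega⟩ * HB.b ⟨1, hn⟩) (g' := HB.b ⟨1, hn⟩ * HB.b ⟨0, by omega⟩) ?_ ?_ ?_ ?_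
    · rw [HB.mem_fixedNatural] at hx ⊢
      rw [← HB.flat_sharp, HB.sharp_sharp, ← hx, ← HB.flat_sharp, HB.flat_flat, HB.flat_sharp, hx]
    · rw [HB.mem_eigen, HB.mem_fixedNatural, pow_zero, one_smul, and_comm, ← HB.flat_sharp]
      exact and_congr_left fun h => by rw [h]
    · rw [HB.mem_eigen, HB.mem_fixedNatural, pow_one, neg_one_smul, and_comm, ← HB.flat_sharp]
      exact and_congr_left fun h => by rw [h, map_neg, neg_eq_iff_eq_neg]
    · rw [HB.mem_eigen, pow_one, neg_one_smul, map_mul, map_mul, hB0, hB1, hF0, hF1]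
      exact ⟨neg_mul _ _, mul_neg _ _⟩
    · rw [HB.mem_fixedNatural, map_mul, HB.natural_b, HB.natural_b, neg_mul_neg]
    · rw [mul_assoc, ← mul_assoc (HB.b ⟨1, hn⟩), HB.b_mul_b, one_mul, HB.b_mul_b]
    · rw [mul_assoc, ← mul_assoc (HB.b ⟨0, _⟩), HB.b_mul_b, one_mul, HB.b_mul_b]
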